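/- Let $K$ be a field and let $G$ be a connected simple graph on the vertex set $[n]=\{1,\dots,n\}$. Let $S=K[x_1,\dots,x_n,y_1,\dots,y_n]$ with the standard grading, and let $J_G\subseteq S$ be the binomial edge ideal of $G$, generated by all $x_iy_j-x_jy_i$ with $i<j$ and $\{i,j\}$ an edge of $G$. Let $\ell(G)$ be the length (number of edges) of a longest induced path of $G$, and for a finitely generated graded $S$-module $M$ let $\operatorname{reg}(M)=\sup\{\,j-i : \beta_{i,j}(M)\neq 0\,\}$ be its Castelnuovo–Mumford regularity, where $\beta_{i,j}(M)$ are the graded Betti numbers of $M$ over $S$, i.e. the number of summands $S(-j)$ in homological degree $i$ of a minimal graded free resolution of $M$. Then for every integer $s\ge 1$ such that $n\geq 2$ or $s=1$, $$\operatorname{reg}(S/J_G^s)\;\ge\; 2s+\ell(G)-2 .$$ -/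

import Mathlib

namespace BinomialEdge

open MvPolynomial

/-- The polynomial ring `S = K[x_1, …, x_n, y_1, …, y_n]`; the variable `x_i` is `X (Sum.inl i)`
and `y_i` is `X (Sum.inr i)`. -/
abbrev PolyRing (K : Type*) [Field K] (n : ℕ) : Type _ := MvPolynomial (Fin n ⊕ Fin n) K

/-- The binomial edge ideal `J_G`, generated by the binomials `x_i y_j - x_j y_i`, where `i < j`
and `{i, j}` is an edge of `G`. -/
noncomputable def binomialEdgeIdeal (K : Type*) [Field K] {n : ℕ} (G : SimpleGraph (Fin n)) :
    Ideal (PolyRing K n) :=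
  Ideal.span {f | ∃ i j : Fin n, i < j ∧ G.Adj i j ∧
    f = X (Sum.inl i) * X (Sum.inr j) - X (Sum.inl j) * X (Sum.inr i)}

/-- The length (number of edges) of a longest induced path of `G`. The path with `k` edges is
`SimpleGraph.pathGraph (k + 1)`, and a graph embedding `↪g` identifies it with an induced
subgraph of `G`. -/
noncomputable def longestInducedPath {V : Type*} (G : SimpleGraph V) : ℕ :=
  sSup {k : ℕ | Nonempty (SimpleGraph.pathGraph (k + 1) ↪g G)}

/-- A minimal graded free resolution
`⋯ → F_2 → F_1 → F_0 → M → 0` by finitely generated graded free modules over the standard graded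
polynomial ring `S = K[X_σ]` of a graded `S`-module `M`, where `𝓜 j` is the degree `j` part of
`M`. Here `F_i = ⨁_b S(-shift i b)`, the sum over `b : Fin (rank i)`, that is, the
basis vector `e_b` of `F_i` is homogeneous of degree `shift i b`. -/
structure MinimalGradedFreeResolution {σ K M : Type*} [Field K] [AddCommGroup M] [Module K M]
    [Module (MvPolynomial σ K) M] (𝓜 : ℕ → Submodule K M) where
  /-- the rank of `F_i` -/
  rank : ℕ → ℕ
  /-- the degrees of the basis vectors of `F_i` -/
  shift : (i : ℕ) → Fin (rank i) → ℕ
  /-- the differential `F_{i+1} → F_i` -/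
  d : (i : ℕ) →
    (Fin (rank (i + 1)) → MvPolynomial σ K) →ₗ[MvPolynomial σ K] (Fin (rank i) → MvPolynomial σ K)
  /-- the augmentation `F_0 → M` -/
  aug : (Fin (rank 0) → MvPolynomial σ K) →ₗ[MvPolynomial σ K] M
  aug_surjective : Function.Surjective aug
  exact_aug : Function.Exact (d 0) aug
  exact_d : ∀ i, Function.Exact (d (i + 1)) (d i)
  /-- the augmentation is homogeneous of degree `0` -/
  aug_homogeneous : ∀ b, aug (Pi.single b 1) ∈ 𝓜 (shift 0 b)
  /-- the differentials are homogeneous of degree `0`: the entry of `d` at `(a, b)` is a form of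
  degree `shift (i + 1) b - shift i a` (which is zero if this number is negative) -/
  d_homogeneous : ∀ i b a, ∀ m ∈ (d i (Pi.single b 1) a).support,
    m.degree + shift i a = shift (i + 1) b
  /-- minimality: the entries of the differentials lie in the graded maximal ideal -/
  minimal : ∀ i b a, constantCoeff (d i (Pi.single b 1) a) = 0

/-- The graded Betti number `β_{i,j}`, read off from a minimal graded free resolution: the number
of copies of `S(-j)` in `F_i`. -/
def MinimalGradedFreeResolution.betti {σ K M : Type*} [Field K] [AddCommGroup M] [Module K M]
    [Module (MvPolynomial σ K) M] {𝓜 : ℕ → Submodule K M}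
    (F : MinimalGradedFreeResolution (σ := σ) 𝓜) (i j : ℕ) : ℕ :=
  (Finset.univ.filter fun b : Fin (F.rank i) => F.shift i b = j).card

/-- The Castelnuovo–Mumford regularity `sup {j - i | β_{i,j}(M) ≠ 0}` of a graded module `M` over
`K[X_σ]`, in the extended reals; it is `⊥` for the zero module. Minimal graded free resolutions are
unique up to isomorphism, so all of them give the same Betti numbers. -/
noncomputable def regularity (σ : Type*) {K M : Type*} [Field K] [AddCommGroup M] [Module K M]
    [Module (MvPolynomial σ K) M] (𝓜 : ℕ → Submodule K M) : EReal :=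
  sSup {r : EReal | ∃ (F : MinimalGradedFreeResolution (σ := σ) 𝓜) (i j : ℕ),
    F.betti i j ≠ 0 ∧ r = (((j : ℝ) - (i : ℝ) : ℝ) : EReal)}

/-- The standard grading of `K[X_σ] / I` for a homogeneous ideal `I`: the degree `j` part consists
of the classes of the forms of degree `j`. -/
noncomputable def quotientGrading {σ K : Type*} [Field K] (I : Ideal (MvPolynomial σ K)) (j : ℕ) :
    Submodule K (MvPolynomial σ K ⧸ I) :=
  (homogeneousSubmodule σ K j).map (Ideal.Quotient.mkₐ K I).toLinearMap

/-- The regularity `reg (S / I)` of the quotient of `S = K[X_σ]` by a homogeneous ideal `I`. -/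
noncomputable def regQuotient {σ K : Type*} [Field K] (I : Ideal (MvPolynomial σ K)) : EReal :=
  regularity σ (quotientGrading I)

end BinomialEdge

/-! Write s + 1 for the exponent and let l ≥ 1 be the length of a longest induced path, with
vertices 0, …, l. It suffices to find a basis vector of degree 2s + 2l in homological degree l of
one minimal resolution F of S/J^(s+1), because the regularity is at least (2s + 2l) - l = 2(s + 1) +
l - 2. Since `regularity` is a supremum over resolutions, one of them has to be constructed
(`quotientResolution`).

The Betti number is detected by an explicit Koszul class. In the Koszul complex on the variables
y_0, …, y_l of the path, the vector v_j = x_j e_{j+1} - x_{j+1} e_j has boundary f_j = x_j y_{j+1} -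
x_{j+1} y_j, a generator of J. Hence the chain v_{l-1} ∧ ⋯ ∧ v_0 with coefficient f_0^s becomes a
cycle modulo J^(s+1). Lifting its boundary repeatedly through F ends in exterior degree 0 with an
element of F_l of degree 2s + 2l. If F_l has no basis vector of that degree, this element has no
constant terms.

In that case, specialize to K[z_1, …, z_l] by x_k ↦ z_{k+1}, y_k ↦ z_k, with z_0 = z_{l+1} = 0, and
all variables off the path to 0. As y_0 ↦ 0, the vector e_0 can be dropped, leaving the Koszul
complex on all the variables z_1, …, z_l. It is exact up to constant terms, so the zigzag can be
undone, and the specialized chain is a Koszul boundary plus a chain with coefficients in the image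
of F_1 (`exists_shift_eq_or_exists_eq_add`). Boundaries have no top component, so comparing top
coefficients puts g_1^s z_1⋯z_l into (g_1, …, g_l)^(s+1), where g_k = z_k^2 - z_{k+1} z_{k-1}.

This is impossible (`pow_mul_prod_X_notMem`): for a strictly concave weight, g_k has leading term
z_k^2, so each polynomial is uniquely a combination of products of powers of the g_k with squarefree
monomials, and the power of the ideal consists of the combinations with at least s + 1 factors g_k.
-/

namespace BinomialEdge

/-! ### Koszul complexes, defined recursively -/

/-- The underlying module of the Koszul complex of a sequence of length `n` with coefficients
in `A`; a pair `(p, q)` stands for `p + e_n ∧ q`. -/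
def Kos (A : Type*) : ℕ → Type _
  | 0 => A
  | n + 1 => Kos A n × Kos A n

namespace Kos

instance instAddCommGroup (A : Type*) [AddCommGroup A] : ∀ n, AddCommGroup (Kos A n)
  | 0 => inferInstanceAs (AddCommGroup A)
  | n + 1 =>
    letI := instAddCommGroup A n
    inferInstanceAs (AddCommGroup (Kos A n × Kos A n))

instance instModule (R A : Type*) [CommRing R] [AddCommGroup A] [Module R A] :
    ∀ n, Module R (Kos A n)
  | 0 => inferInstanceAs (Module R A)
  | n + 1 =>
    letI := instModule R A n
    inferInstanceAs (Module R (Kos A n × Kos A n))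

/-- The element `p + e_n ∧ q`. -/
def mk {A : Type*} {n : ℕ} (p q : Kos A n) : Kos A (n + 1) := (p, q)

lemma exists_mk {A : Type*} {n : ℕ} (c : Kos A (n + 1)) : ∃ p q, c = mk p q := ⟨c.1, c.2, rfl⟩

lemma mk_inj {A : Type*} {n : ℕ} {p q p' q' : Kos A n} (h : mk p q = mk p' q') :
    p = p' ∧ q = q' :=
  Prod.mk.inj h

section Basic

variable {R A B C : Type*} [CommRing R] [AddCommGroup A] [AddCommGroup B] [AddCommGroup C]
  [Module R A] [Module R B]

/-- The Koszul differential of the sequence `t 0, …, t (n - 1)`. -/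
def d (t : ℕ → R) : ∀ n, Kos A n →ₗ[R] Kos A n
  | 0 => 0
  | n + 1 => LinearMap.prod
      ((d t n).comp (LinearMap.fst R (Kos A n) (Kos A n)) +
        t n • LinearMap.snd R (Kos A n) (Kos A n))
      (-(d t n).comp (LinearMap.snd R (Kos A n) (Kos A n)))

/-- Left multiplication by the vector `∑ a i • e_i`. -/
def wedge (a : ℕ → R) : ∀ n, Kos A n →ₗ[R] Kos A n
  | 0 => 0
  | n + 1 => LinearMap.prod
      ((wedge a n).comp (LinearMap.fst R (Kos A n) (Kos A n)))
      (a n • LinearMap.fst R (Kos A n) (Kos A n) -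
        (wedge a n).comp (LinearMap.snd R (Kos A n) (Kos A n)))

/-- The map of Koszul complexes induced by a map of coefficients. -/
def map (f : A →+ B) : ∀ n, Kos A n →+ Kos B n
  | 0 => f
  | n + 1 => (map f n).prodMap (map f n)

/-- The map of Koszul complexes which changes the coefficients and kills `e_0`. -/
def drop (f : A →+ B) : ∀ n, Kos A (n + 1) →+ Kos B n
  | 0 => f.comp (AddMonoidHom.fst A A)
  | n + 1 => (drop f n).prodMap (drop f n)

/-- The coefficient of the product of all `e_i`. -/
def top : ∀ n, Kos A n →+ A
  | 0 => AddMonoidHom.id A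
  | n + 1 => (top n).comp (AddMonoidHom.snd (Kos A n) (Kos A n))

/-- The component of exterior degree zero. -/
def bot : ∀ n, Kos A n →+ A
  | 0 => AddMonoidHom.id A
  | n + 1 => (bot n).comp (AddMonoidHom.fst (Kos A n) (Kos A n))

/-- The inclusion of the component of exterior degree zero. -/
def incl : ∀ n, A →+ Kos A n
  | 0 => AddMonoidHom.id A
  | n + 1 => (AddMonoidHom.inl (Kos A n) (Kos A n)).comp (incl n)

lemma d_zero (t : ℕ → R) (c : Kos A 0) : d t 0 c = 0 := rfl

lemma d_succ (t : ℕ → R) (n : ℕ) (p q : Kos A n) :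
    d t (n + 1) (mk p q) =
      mk (d t n p + t n • q) (-d t n q) := rfl

lemma wedge_zero (a : ℕ → R) (c : Kos A 0) : wedge a 0 c = 0 := rfl

lemma wedge_succ (a : ℕ → R) (n : ℕ) (p q : Kos A n) :
    wedge a (n + 1) (mk p q) =
      mk (wedge a n p) (a n • p - wedge a n q) := rfl

lemma map_succ (f : A →+ B) (n : ℕ) (p q : Kos A n) :
    map f (n + 1) (mk p q) =
      mk (map f n p) (map f n q) := rfl

lemma drop_zero (f : A →+ B) (p q : Kos A 0) :
    drop f 0 (mk p q) = f p := rfl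

lemma drop_succ (f : A →+ B) (n : ℕ) (p q : Kos A (n + 1)) :
    drop f (n + 1) (mk p q) =
      mk (drop f n p) (drop f n q) := rfl

lemma top_succ (n : ℕ) (p q : Kos A n) :
    top (n + 1) (mk p q) = top n q := rfl

lemma bot_succ (n : ℕ) (p q : Kos A n) :
    bot (n + 1) (mk p q) = bot n p := rfl

lemma incl_succ (n : ℕ) (a : A) :
    incl (n + 1) a = mk (incl n a) 0 := rfl

lemma smul_mk (r : R) (n : ℕ) (p q : Kos A n) :
    (r • (mk p q) : Kos A (n + 1)) =
      mk (r • p) (r • q) := rfl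

lemma add_mk (n : ℕ) (p q p' q' : Kos A n) :
    mk p q + mk p' q' = mk (p + p') (q + q') := rfl

lemma zero_mk (n : ℕ) : (0 : Kos A (n + 1)) = mk 0 0 := rfl

lemma d_d (t : ℕ → R) : ∀ n (c : Kos A n), d t n (d t n c) = 0
  | 0, _ => rfl
  | n + 1, c => by
    obtain ⟨p, q, rfl⟩ := exists_mk c
    rw [d_succ, d_succ, zero_mk, map_neg, neg_neg, map_add, d_d t n, LinearMap.map_smul, d_d t n]
    simp

/-- The Leibniz rule: the boundary is an antiderivation, and the boundary of `∑ a i • e_i` is the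
scalar `∑ a i * t i`. -/
lemma d_wedge (t a : ℕ → R) : ∀ n (c : Kos A n),
    d t n (wedge a n c) = (∑ i ∈ Finset.range n, a i * t i) • c - wedge a n (d t n c)
  | 0, c => by simp [d_zero, wedge_zero]
  | n + 1, c => by
    obtain ⟨p, q, rfl⟩ := exists_mk c
    rw [eq_sub_iff_add_eq, wedge_succ, d_succ, d_succ, wedge_succ, add_mk, smul_mk]
    simp only [map_add, map_sub, map_neg, map_smul, d_wedge t a n, Finset.sum_range_succ, add_smul,
      smul_sub, smul_add, mul_smul, smul_comm (t n) (a n)]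
    congr 1 <;> abel

lemma d_incl (t : ℕ → R) : ∀ n (a : A), d t n (incl n a) = 0
  | 0, _ => rfl
  | n + 1, a => by rw [incl_succ, d_succ, d_incl t n, zero_mk]; simp

lemma top_d (t : ℕ → R) : ∀ n (c : Kos A n), top n (d t n c) = 0
  | 0, _ => rfl
  | n + 1, c => by
    obtain ⟨p, q, rfl⟩ := exists_mk c
    rw [d_succ, top_succ, map_neg, top_d t n, neg_zero]

lemma top_smul (r : R) : ∀ n (c : Kos A n), top n (r • c) = r • top n c
  | 0, _ => rfl
  | n + 1, c => by
    obtain ⟨p, q, rfl⟩ := exists_mk c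
    rw [smul_mk, top_succ, top_succ, top_smul r n]

lemma bot_smul (r : R) : ∀ n (c : Kos A n), bot n (r • c) = r • bot n c
  | 0, _ => rfl
  | n + 1, c => bot_smul r n c.1

lemma incl_smul (r : R) : ∀ n (a : A), r • incl n a = incl n (r • a)
  | 0, _ => rfl
  | n + 1, a => by rw [incl_succ, incl_succ, smul_mk, incl_smul r n, smul_zero]

lemma top_map (f : A →+ B) : ∀ n (c : Kos A n), top n (map f n c) = f (top n c)
  | 0, _ => rfl
  | n + 1, c => top_map f n c.2

lemma bot_map (f : A →+ B) : ∀ n (c : Kos A n), bot n (map f n c) = f (bot n c)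
  | 0, _ => rfl
  | n + 1, c => bot_map f n c.1

lemma bot_incl : ∀ n (a : A), bot n (incl n a) = a
  | 0, _ => rfl
  | n + 1, a => bot_incl n a

lemma bot_drop (f : A →+ B) : ∀ n (c : Kos A (n + 1)),
    bot n (drop f n c) = f (bot (n + 1) c)
  | 0, (_, _) => rfl
  | n + 1, c => bot_drop f n c.1

lemma drop_incl (f : A →+ B) : ∀ n (a : A), drop f n (incl (n + 1) a) = incl n (f a)
  | 0, _ => rfl
  | n + 1, a => by
    rw [incl_succ, drop_succ, drop_incl f n, map_zero, ← incl_succ]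

lemma map_incl (f : A →+ B) : ∀ n (a : A), map f n (incl n a) = incl n (f a)
  | 0, _ => rfl
  | n + 1, a => by rw [incl_succ, map_succ, map_incl f n, map_zero, ← incl_succ]

lemma map_map (f : A →+ B) (g : B →+ C) : ∀ n (c : Kos A n),
    map g n (map f n c) = map (g.comp f) n c
  | 0, _ => rfl
  | n + 1, c => by
    obtain ⟨p, q, rfl⟩ := exists_mk c
    rw [map_succ, map_succ, map_succ, map_map f g n, map_map f g n]

lemma map_zero_hom : ∀ n (c : Kos A n), map (0 : A →+ B) n c = 0
  | 0, _ => rfl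
  | n + 1, c => by
    obtain ⟨p, q, rfl⟩ := exists_mk c
    rw [map_succ, map_zero_hom n, map_zero_hom n, zero_mk]

end Basic

/-! ### Change of rings and coefficients -/

section Semilinear

variable {R S A B A' B' : Type*} [CommRing R] [CommRing S] [AddCommGroup A] [AddCommGroup B]
  [AddCommGroup A'] [AddCommGroup B'] [Module R A] [Module S B]

lemma map_smul {φ : R →+* S} {f : A →+ B} (hf : ∀ r a, f (r • a) = φ r • f a) (r : R) :
    ∀ n (c : Kos A n), map f n (r • c) = φ r • map f n c
  | 0, c => hf r c
  | n + 1, c => by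
    obtain ⟨p, q, rfl⟩ := exists_mk c
    rw [smul_mk, map_succ, map_succ, smul_mk, map_smul hf r n, map_smul hf r n]

lemma drop_smul {φ : R →+* S} {f : A →+ B} (hf : ∀ r a, f (r • a) = φ r • f a) (r : R) :
    ∀ n (c : Kos A (n + 1)), drop f n (r • c) = φ r • drop f n c
  | 0, c => by
    obtain ⟨p, q, rfl⟩ := exists_mk c
    rw [smul_mk]; exact hf r p
  | n + 1, c => by
    obtain ⟨p, q, rfl⟩ := exists_mk c
    rw [smul_mk, drop_succ, drop_succ, smul_mk, drop_smul hf r n, drop_smul hf r n]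

lemma map_d {φ : R →+* S} {f : A →+ B} (hf : ∀ r a, f (r • a) = φ r • f a) (t : ℕ → R) :
    ∀ n (c : Kos A n), map f n (d t n c) = d (fun i => φ (t i)) n (map f n c)
  | 0, _ => map_zero f
  | n + 1, c => by
    obtain ⟨p, q, rfl⟩ := exists_mk c
    rw [d_succ, map_succ, map_succ, d_succ, map_add, map_neg, map_smul hf, map_d hf t n,
      map_d hf t n]

lemma map_wedge {φ : R →+* S} {f : A →+ B} (hf : ∀ r a, f (r • a) = φ r • f a) (a : ℕ → R) :
    ∀ n (c : Kos A n), map f n (wedge a n c) = wedge (fun i => φ (a i)) n (map f n c)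
  | 0, _ => map_zero f
  | n + 1, c => by
    obtain ⟨p, q, rfl⟩ := exists_mk c
    rw [wedge_succ, map_succ, map_succ, wedge_succ, map_sub, map_smul hf, map_wedge hf a n,
      map_wedge hf a n]

/-- Killing `e_0` is compatible with the boundary because the boundary of `e_0` is `t 0`, which `φ`
kills. The remaining indices move down by one. -/
lemma drop_d {φ : R →+* S} {f : A →+ B} (hf : ∀ r a, f (r • a) = φ r • f a) (t : ℕ → R)
    (ht : φ (t 0) = 0) :
    ∀ n (c : Kos A (n + 1)), drop f n (d t (n + 1) c) = d (fun i => φ (t (i + 1))) n (drop f n c)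
  | 0, c => by
    obtain ⟨p, q, rfl⟩ := exists_mk c
    rw [d_succ, d_zero, drop_zero, d_zero, zero_add]
    exact (hf _ _).trans (by rw [ht, zero_smul]; rfl)
  | n + 1, c => by
    obtain ⟨p, q, rfl⟩ := exists_mk c
    rw [d_succ, drop_succ, drop_succ, d_succ, map_add, map_neg, drop_smul hf, drop_d hf t ht n,
      drop_d hf t ht n]

lemma drop_wedge {φ : R →+* S} {f : A →+ B} (hf : ∀ r a, f (r • a) = φ r • f a) (a : ℕ → R) :
    ∀ n (c : Kos A (n + 1)),
      drop f n (wedge a (n + 1) c) = wedge (fun i => φ (a (i + 1))) n (drop f n c)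
  | 0, c => by
    obtain ⟨p, q, rfl⟩ := exists_mk c
    rw [wedge_succ, wedge_zero, drop_zero, wedge_zero]
    exact map_zero f
  | n + 1, c => by
    obtain ⟨p, q, rfl⟩ := exists_mk c
    rw [wedge_succ, drop_succ, drop_succ, wedge_succ, map_sub, drop_smul hf, drop_wedge hf a n,
      drop_wedge hf a n]

lemma drop_map {f : A →+ B} {g : A →+ A'} {f' : A' →+ B'} {g' : B →+ B'}
    (h : ∀ a, f' (g a) = g' (f a)) :
    ∀ n (c : Kos A (n + 1)), drop f' n (map g (n + 1) c) = map g' n (drop f n c)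
  | 0, (p, q) => h p
  | n + 1, c => by
    obtain ⟨p, q, rfl⟩ := exists_mk c
    rw [map_succ, drop_succ, drop_succ, map_succ, drop_map h n, drop_map h n]

end Semilinear

/-! ### Exactness in the coefficients and the exterior grading -/

section Exact

variable {A B C : Type*} [AddCommGroup A] [AddCommGroup B] [AddCommGroup C]

lemma map_exact {f : A →+ B} {g : B →+ C} (h : ∀ b, g b = 0 → ∃ a, f a = b) :
    ∀ n (c : Kos B n), map g n c = 0 → ∃ c', map f n c' = c
  | 0, c, hc => h c hc
  | n + 1, c, hc => by
    obtain ⟨p, q, rfl⟩ := exists_mk c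
    obtain ⟨h1, h2⟩ := mk_inj hc
    obtain ⟨p', rfl⟩ := map_exact h n p h1
    obtain ⟨q', rfl⟩ := map_exact h n q h2
    exact ⟨mk p' q', rfl⟩

/-- The part of exterior degree `h`, with coefficients in a subgroup `P`. -/
def Gr (P : AddSubgroup A) : ∀ n, ℕ → Kos A n → Prop
  | 0, 0, c => c ∈ P
  | 0, _ + 1, c => c = 0
  | n + 1, 0, c => Gr P n 0 c.1 ∧ c.2 = 0
  | n + 1, h + 1, c => Gr P n (h + 1) c.1 ∧ Gr P n h c.2

lemma Gr.zero (P : AddSubgroup A) : ∀ n h, Gr P n h 0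
  | 0, 0 => P.zero_mem
  | 0, _ + 1 => rfl
  | n + 1, 0 => ⟨Gr.zero P n 0, rfl⟩
  | n + 1, h + 1 => ⟨Gr.zero P n (h + 1), Gr.zero P n h⟩

lemma Gr.add {P : AddSubgroup A} : ∀ {n h} {c c' : Kos A n},
    Gr P n h c → Gr P n h c' → Gr P n h (c + c')
  | 0, 0, _, _, hc, hc' => P.add_mem hc hc'
  | 0, _ + 1, _, _, hc, hc' => by
    change _ = _ at hc hc'
    subst hc hc'
    exact add_zero _
  | n + 1, 0, (p, q), (p', q'), hc, hc' => ⟨Gr.add hc.1 hc'.1, by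
    have h1 : q = 0 := hc.2
    have h2 : q' = 0 := hc'.2
    subst h1 h2
    exact add_zero _⟩
  | n + 1, h + 1, (p, q), (p', q'), hc, hc' => ⟨Gr.add hc.1 hc'.1, Gr.add hc.2 hc'.2⟩

lemma Gr.neg {P : AddSubgroup A} : ∀ {n h} {c : Kos A n}, Gr P n h c → Gr P n h (-c)
  | 0, 0, _, hc => P.neg_mem hc
  | 0, _ + 1, _, hc => by
    change _ = _ at hc
    subst hc
    exact neg_zero
  | n + 1, 0, (p, q), hc => ⟨Gr.neg hc.1, by
    have h1 : q = 0 := hc.2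
    subst h1
    exact neg_zero⟩
  | n + 1, h + 1, (p, q), hc => ⟨Gr.neg hc.1, Gr.neg hc.2⟩

lemma Gr.smul {R : Type*} [CommRing R] [Module R A] {P Q : AddSubgroup A} {r : R}
    (hr : ∀ a ∈ P, r • a ∈ Q) : ∀ {n h} {c : Kos A n}, Gr P n h c → Gr Q n h (r • c)
  | 0, 0, c, hc => hr c hc
  | 0, _ + 1, _, hc => by
    change _ = _ at hc
    subst hc
    exact smul_zero _
  | n + 1, 0, (p, q), hc => ⟨Gr.smul hr hc.1, by
    have h1 : q = 0 := hc.2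
    subst h1
    exact smul_zero _⟩
  | n + 1, h + 1, (p, q), hc => ⟨Gr.smul hr hc.1, Gr.smul hr hc.2⟩

lemma Gr.d_eq_zero {R : Type*} [CommRing R] [Module R A] {P : AddSubgroup A} (t : ℕ → R) :
    ∀ {n} {c : Kos A n}, Gr P n 0 c → d t n c = 0
  | 0, _, _ => rfl
  | n + 1, c, hc => by
    obtain ⟨p, q, rfl⟩ := exists_mk c
    have h1 : q = 0 := hc.2
    subst h1
    have h2 : d t n p = 0 := Gr.d_eq_zero t hc.1
    rw [d_succ, h2, zero_mk]
    simp

lemma Gr.d {R : Type*} [CommRing R] [Module R A] {P Q : AddSubgroup A} {t : ℕ → R}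
    (hr : ∀ i, ∀ a ∈ P, t i • a ∈ Q) : ∀ {n h} {c : Kos A n}, Gr P n (h + 1) c →
      Gr Q n h (d t n c)
  | 0, _, _, _ => Gr.zero _ _ _
  | n + 1, 0, c, hc => by
    obtain ⟨p, q, rfl⟩ := exists_mk c
    rw [d_succ]
    exact ⟨Gr.add (Gr.d hr hc.1) (Gr.smul (hr n) hc.2), by
      change -Kos.d t n q = 0
      have h1 : Kos.d t n q = 0 := Gr.d_eq_zero t hc.2
      rw [h1, neg_zero]⟩
  | n + 1, h + 1, c, hc => by
    obtain ⟨p, q, rfl⟩ := exists_mk c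
    rw [d_succ]
    exact ⟨Gr.add (Gr.d hr hc.1) (Gr.smul (hr n) hc.2), Gr.neg (Gr.d hr hc.2)⟩

lemma Gr.wedge {R : Type*} [CommRing R] [Module R A] {P Q : AddSubgroup A} {t : ℕ → R}
    (hr : ∀ i, ∀ a ∈ P, t i • a ∈ Q) : ∀ {n h} {c : Kos A n}, Gr P n h c →
      Gr Q n (h + 1) (wedge t n c)
  | 0, _, _, _ => Gr.zero _ _ _
  | n + 1, 0, c, hc => by
    obtain ⟨p, q, rfl⟩ := exists_mk c
    have h1 : q = 0 := hc.2
    subst h1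
    rw [wedge_succ, map_zero, sub_zero]
    exact ⟨Gr.wedge hr hc.1, Gr.smul (hr n) hc.1⟩
  | n + 1, h + 1, c, hc => by
    obtain ⟨p, q, rfl⟩ := exists_mk c
    rw [wedge_succ, sub_eq_add_neg]
    exact ⟨Gr.wedge hr hc.1, Gr.add (Gr.smul (hr n) hc.1) (Gr.neg (Gr.wedge hr hc.2))⟩

lemma Gr.incl {P : AddSubgroup A} {a : A} (ha : a ∈ P) : ∀ n, Gr P n 0 (incl n a)
  | 0 => ha
  | n + 1 => ⟨Gr.incl ha n, rfl⟩

lemma Gr.bot_eq_zero {P : AddSubgroup A} : ∀ {n h} {c : Kos A n}, Gr P n (h + 1) c →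
    bot n c = 0
  | 0, _, _, hc => hc
  | n + 1, _, (_, _), hc => Gr.bot_eq_zero (n := n) hc.1

lemma Gr.eq_incl {P : AddSubgroup A} : ∀ {n} {c : Kos A n}, Gr P n 0 c →
    c = Kos.incl n (bot n c) ∧ bot n c ∈ P
  | 0, _, hc => ⟨rfl, hc⟩
  | n + 1, c, hc => by
    obtain ⟨p, q, rfl⟩ := exists_mk c
    have h1 : q = 0 := hc.2
    subst h1
    obtain ⟨h2, h3⟩ : p = Kos.incl n (bot n p) ∧ bot n p ∈ P := Gr.eq_incl hc.1
    refine ⟨?_, h3⟩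
    rw [incl_succ, bot_succ, ← h2]

lemma Gr.exists_lift {f : A →+ B} {P : AddSubgroup A} {Q : AddSubgroup B}
    (hf : ∀ a, f a ∈ Q → ∃ a' ∈ P, f a' = f a) : ∀ {n h} {c : Kos A n},
      Gr Q n h (map f n c) → ∃ c', Gr P n h c' ∧ map f n c' = map f n c
  | 0, 0, c, hc => hf c hc
  | 0, _ + 1, c, hc => ⟨0, rfl, (map_zero _).trans (Eq.symm hc)⟩
  | n + 1, 0, c, hc => by
    obtain ⟨p, q, rfl⟩ := exists_mk c
    obtain ⟨p', h1, h2⟩ := Gr.exists_lift (c := p) hf hc.1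
    have h3 : map f n q = 0 := hc.2
    exact ⟨mk p' 0, ⟨h1, rfl⟩, by rw [map_succ, map_succ, h2, h3, map_zero]⟩
  | n + 1, h + 1, c, hc => by
    obtain ⟨p, q, rfl⟩ := exists_mk c
    obtain ⟨p', h1, h2⟩ := Gr.exists_lift (c := p) hf hc.1
    obtain ⟨q', h3, h4⟩ := Gr.exists_lift (c := q) hf hc.2
    exact ⟨mk p' q', ⟨h1, h3⟩, by rw [map_succ, map_succ, h2, h4]⟩

end Exact

/-! ### Koszul complexes of regular sequences -/

section Regular

variable {R A : Type*} [CommRing R] [AddCommGroup A] [Module R A] {t : ℕ → R}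
  {N : ℕ → Submodule R A}

/-- Here and below `N n` plays the role of the submodule `(t 0, …, t (n - 1)) A`. -/
lemma bot_d_mem (hN : ∀ n, N n ≤ N (n + 1)) (ht : ∀ n a, t n • a ∈ N (n + 1)) :
    ∀ n (c : Kos A n), bot n (d t n c) ∈ N n
  | 0, _ => (N 0).zero_mem
  | n + 1, c => by
    obtain ⟨p, q, rfl⟩ := exists_mk c
    rw [d_succ, bot_succ, map_add, bot_smul]
    exact (N (n + 1)).add_mem (hN n (bot_d_mem hN ht n p)) (ht n _)

lemma exists_d_eq_incl (h0 : N 0 = ⊥) (hN : ∀ n, ∀ a ∈ N (n + 1), ∃ b ∈ N n, ∃ c, a = b + t n • c) :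
    ∀ n, ∀ a ∈ N n, ∃ c : Kos A n, d t n c = incl n a
  | 0, a, ha => ⟨0, by
    rw [h0, Submodule.mem_bot] at ha
    rw [ha, map_zero, map_zero]⟩
  | n + 1, a, ha => by
    obtain ⟨b, hb, x, rfl⟩ := hN n a ha
    obtain ⟨c, hc⟩ := exists_d_eq_incl h0 hN n b hb
    refine ⟨mk c (incl n x), ?_⟩
    rw [d_succ, d_incl, incl_succ, hc, map_add, incl_smul, neg_zero]

/-- The Koszul complex of a regular sequence is exact in positive exterior degrees. -/
lemma exists_eq_d_add_incl (h0 : N 0 = ⊥) (hle : ∀ n, N n ≤ N (n + 1))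
    (ht : ∀ n a, t n • a ∈ N (n + 1))
    (hN : ∀ n, ∀ a ∈ N (n + 1), ∃ b ∈ N n, ∃ c, a = b + t n • c) :
    ∀ m, (∀ n < m, ∀ a, t n • a ∈ N n → a ∈ N n) → ∀ c : Kos A m, d t m c = 0 →
      ∃ b a, c = d t m b + incl m a
  | 0, _, c, _ => ⟨0, c, by rw [map_zero, zero_add]; rfl⟩
  | m + 1, hreg, c, hc => by
    obtain ⟨p, q, rfl⟩ := exists_mk c
    rw [d_succ, zero_mk] at hc
    obtain ⟨h1, h2⟩ := mk_inj hc
    rw [neg_eq_zero] at h2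
    have ih := exists_eq_d_add_incl h0 hle ht hN m fun n hn => hreg n (hn.trans (Nat.lt_succ_self m))
    obtain ⟨b, a, hq⟩ := ih q h2
    -- The first component of `hc` makes `t m • a` a boundary; regularity of `t m` modulo `N m` then
    -- turns `a` itself into a boundary, so that `q` is one too.
    have h3 : t m • a ∈ N m := by
      have h4 : incl m (t m • a) = -d t m (p + t m • b) := by
        rw [hq, smul_add, ← add_assoc] at h1
        rw [map_add, LinearMap.map_smul, eq_comm, neg_eq_iff_add_eq_zero, ← incl_smul]
        exact h1
      rw [← bot_incl m (t m • a), h4, map_neg]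
      exact (N m).neg_mem (bot_d_mem hle ht m _)
    obtain ⟨b', hb'⟩ := exists_d_eq_incl h0 hN m a (hreg m (Nat.lt_succ_self m) a h3)
    rw [← hb', ← map_add] at hq
    obtain ⟨u, x, hx⟩ := ih (p + t m • (b + b')) (by
      rw [map_add, LinearMap.map_smul, ← hq]; exact h1)
    refine ⟨mk u (-(b + b')), x, ?_⟩
    rw [d_succ, incl_succ, add_mk, map_neg, neg_neg, add_zero, ← hq, smul_neg, add_right_comm, ← hx,
      add_neg_cancel_right]

end Regular

/-! ### Products of vectors in the Koszul complex -/

section Iterated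

variable {R A : Type*} [CommRing R] [AddCommGroup A] [Module R A]

/-- The iterated product `v_{k-1} ∧ ⋯ ∧ v_0 ∧ u`, where `v_j = ∑ a j i • e_i`. -/
def wedges (a : ℕ → ℕ → R) (n : ℕ) (u : A) : ℕ → Kos A n
  | 0 => incl n u
  | k + 1 => wedge (a k) n (wedges a n u k)

/-- By the Leibniz rule, every term of the boundary contains the boundary of one of the vectors as a
scalar, and these scalars annihilate `u`. -/
lemma d_wedges {a : ℕ → ℕ → R} {t : ℕ → R} {n : ℕ} {u : A} : ∀ {k},
    (∀ j < k, (∑ i ∈ Finset.range n, a j i * t i) • u = 0) → d t n (wedges a n u k) = 0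
  | 0, _ => d_incl t n u
  | k + 1, h => by
    have hs : ∀ r : R, r • u = 0 → ∀ k, r • wedges a n u k = 0 := fun r hr k => by
      induction k with
      | zero =>
        rw [wedges, incl_smul, hr, map_zero]
      | succ k ih => rw [wedges, ← LinearMap.map_smul, ih, map_zero]
    rw [wedges, d_wedge, d_wedges fun j hj => h j (hj.trans (Nat.lt_succ_self k)), map_zero,
      sub_zero, hs _ (h k (Nat.lt_succ_self k))]

lemma wedges_succ_of_le {a : ℕ → ℕ → R} (ha : ∀ j i, j < i → a j i = 0) {n : ℕ} {u : A} :
    ∀ {k}, k ≤ n → wedges a (n + 1) u k = mk (wedges a n u k) 0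
  | 0, _ => rfl
  | k + 1, h => by
    rw [wedges, wedges_succ_of_le ha (Nat.le_of_succ_le h), wedge_succ, ha k n h, zero_smul,
      map_zero, sub_zero]
    rfl

/-- The top coefficient is a determinant, here of a triangular matrix. -/
lemma top_wedges {a : ℕ → ℕ → R} (ha : ∀ j i, j < i → a j i = 0) {u : A} :
    ∀ n, top n (wedges a n u n) = (∏ i ∈ Finset.range n, a i i) • u
  | 0 => by simp only [Finset.range_zero, Finset.prod_empty, one_smul]; rfl
  | n + 1 => by
    rw [wedges, wedges_succ_of_le ha le_rfl, wedge_succ, top_succ, map_zero, sub_zero, top_smul,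
      top_wedges ha n, Finset.prod_range_succ, mul_comm, mul_smul]

lemma map_wedges {S B : Type*} [CommRing S] [AddCommGroup B] [Module S B]
    {φ : R →+* S} {f : A →+ B} (hf : ∀ r a, f (r • a) = φ r • f a) (a : ℕ → ℕ → R) (n : ℕ) (u : A) :
    ∀ k, map f n (wedges a n u k) = wedges (fun j i => φ (a j i)) n (f u) k
  | 0 => map_incl f n u
  | k + 1 => by rw [wedges, map_wedge hf, map_wedges hf a n u k, wedges]

lemma drop_wedges {S B : Type*} [CommRing S] [AddCommGroup B] [Module S B]
    {φ : R →+* S} {f : A →+ B} (hf : ∀ r a, f (r • a) = φ r • f a) (a : ℕ → ℕ → R) (n : ℕ) (u : A) :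
    ∀ k, drop f n (wedges a (n + 1) u k) = wedges (fun j i => φ (a j (i + 1))) n (f u) k
  | 0 => drop_incl f n u
  | k + 1 => by rw [wedges, drop_wedge hf, drop_wedges hf a n u k, wedges]

lemma Gr.wedges {P : ℕ → AddSubgroup A} {a : ℕ → ℕ → R} (ha : ∀ j i e, ∀ x ∈ P e, a j i • x ∈ P (e + 1))
    {n e : ℕ} {u : A} (hu : u ∈ P e) : ∀ k, Gr (P (e + k)) n k (wedges a n u k)
  | 0 => Gr.incl hu n
  | k + 1 => Gr.wedge (fun i x hx => ha k i _ x hx) (Gr.wedges ha hu k)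

end Iterated

end Kos

/-! ### Polynomials whose leading monomials are the squares of the variables -/

section LeadingSquares

open MvPolynomial

variable {σ K : Type*} [Field K]

/-- The polynomials all of whose monomials have weight less than `j`. -/
noncomputable def weightLT (K : Type*) [Field K] (w : σ → ℕ) (j : ℕ) :
    Submodule K (MvPolynomial σ K) :=
  restrictSupport K {m | Finsupp.weight w m < j}

lemma weightLT_mono {w : σ → ℕ} {i j : ℕ} (h : i ≤ j) : weightLT K w i ≤ weightLT K w j :=
  restrictSupport_mono K fun _ hm => lt_of_lt_of_le (Set.mem_ofPred.1 hm) h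

lemma monomial_mem_weightLT {w : σ → ℕ} {j : ℕ} {m : σ →₀ ℕ} {c : K}
    (h : Finsupp.weight w m < j) : monomial m c ∈ weightLT K w j :=
  (monomial_mem_restrictSupport K).2 (Or.inl h)

lemma exists_mem_weightLT (w : σ → ℕ) (p : MvPolynomial σ K) : ∃ j, p ∈ weightLT K w j := by
  refine ⟨p.support.sup (Finsupp.weight w) + 1, fun m hm => ?_⟩
  exact Nat.lt_succ_of_le (Finset.le_sup (f := Finsupp.weight w) hm)

lemma mul_monomial_mem_weightLT {w : σ → ℕ} {i : ℕ} {p : MvPolynomial σ K} {m : σ →₀ ℕ} {c : K}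
    (hp : p ∈ weightLT K w i) : p * monomial m c ∈ weightLT K w (i + Finsupp.weight w m) := by
  classical
  intro x hx
  obtain ⟨a, ha, b, hb, rfl⟩ := Finset.mem_add.1 (support_mul _ _ hx)
  have hb' := Finset.mem_singleton.1 (support_monomial_subset hb)
  have ha' : Finsupp.weight w a < i := hp ha
  simp only [Set.mem_ofPred_eq, map_add, hb']
  omega

lemma mul_mem_weightLT {w : σ → ℕ} {i j : ℕ} {p q : MvPolynomial σ K}
    (hp : p ∈ weightLT K w i) (hq : q ∈ weightLT K w j) : p * q ∈ weightLT K w (i + j) := by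
  classical
  intro x hx
  obtain ⟨a, ha, b, hb, rfl⟩ := Finset.mem_add.1 (support_mul _ _ hx)
  have ha' : Finsupp.weight w a < i := hp ha
  have hb' : Finsupp.weight w b < j := hq hb
  simp only [Set.mem_ofPred_eq, map_add]
  omega

/-- The polynomial `p` is the sum of the monomial `m` and of monomials of smaller weight. -/
def HasLead (w : σ → ℕ) (p : MvPolynomial σ K) (m : σ →₀ ℕ) : Prop :=
  p - monomial m 1 ∈ weightLT K w (Finsupp.weight w m)

lemma hasLead_monomial (w : σ → ℕ) (m : σ →₀ ℕ) : HasLead w (monomial m (1 : K)) m := by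
  rw [HasLead, sub_self]
  exact zero_mem _

lemma HasLead.mul {w : σ → ℕ} {p q : MvPolynomial σ K} {m n : σ →₀ ℕ} (hp : HasLead w p m)
    (hq : HasLead w q n) : HasLead w (p * q) (m + n) := by
  have h : p * q - monomial (m + n) 1 = (p - monomial m 1) * (q - monomial n 1) +
      (p - monomial m 1) * monomial n 1 + (q - monomial n 1) * monomial m 1 := by
    rw [show monomial (m + n) (1 : K) = monomial m 1 * monomial n 1 by
      rw [monomial_mul, mul_one]]
    ring
  rw [HasLead, h, map_add]
  refine add_mem (add_mem (mul_mem_weightLT hp hq) (mul_monomial_mem_weightLT hp)) ?_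
  rw [add_comm]
  exact mul_monomial_mem_weightLT hq

lemma HasLead.pow {w : σ → ℕ} {p : MvPolynomial σ K} {m : σ →₀ ℕ} (hp : HasLead w p m) (k : ℕ) :
    HasLead w (p ^ k) (k • m) := by
  induction k with
  | zero => simpa using hasLead_monomial (K := K) w 0
  | succ k ih =>
    rw [pow_succ, succ_nsmul]
    exact ih.mul hp

lemma HasLead.prod {ι : Type*} {w : σ → ℕ} {p : ι → MvPolynomial σ K} {m : ι → σ →₀ ℕ}
    (s : Finset ι) (h : ∀ i ∈ s, HasLead w (p i) (m i)) :
    HasLead w (∏ i ∈ s, p i) (∑ i ∈ s, m i) := by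
  classical
  induction s using Finset.induction_on with
  | empty => simpa using hasLead_monomial (K := K) w 0
  | insert i s hi ih =>
    rw [Finset.prod_insert hi, Finset.sum_insert hi]
    exact (h i (Finset.mem_insert_self i s)).mul
      (ih fun j hj => h j (Finset.mem_insert_of_mem hj))

variable [Fintype σ] (g : σ → MvPolynomial σ K)

/-- The linear endomorphism which replaces the squares of the variables by the polynomials
`g k`. -/
noncomputable def squareSubst : MvPolynomial σ K →ₗ[K] MvPolynomial σ K :=
  (basisMonomials σ K).constr K fun m => ∏ k, (g k ^ (m k / 2) * X k ^ (m k % 2))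

lemma squareSubst_monomial (m : σ →₀ ℕ) :
    squareSubst g (monomial m 1) = ∏ k, (g k ^ (m k / 2) * X k ^ (m k % 2)) := by
  have := (basisMonomials σ K).constr_basis K
    (fun m => ∏ k, (g k ^ (m k / 2) * X k ^ (m k % 2))) m
  rwa [coe_basisMonomials] at this

lemma sum_half_single_add (k : σ) (b : σ →₀ ℕ) :
    ∑ i, (Finsupp.single k 2 + b : σ →₀ ℕ) i / 2 = ∑ i, b i / 2 + 1 := by
  classical
  have h : ∀ i, (Finsupp.single k 2 + b : σ →₀ ℕ) i / 2 = b i / 2 + if i = k then 1 else 0 := fun i => by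
    rcases eq_or_ne i k with rfl | hi
    · rw [Finsupp.add_apply, Finsupp.single_eq_same, if_pos rfl]
      omega
    · rw [Finsupp.add_apply, Finsupp.single_eq_of_ne hi, if_neg hi]
      omega
  rw [Finset.sum_congr rfl fun i _ => h i, Finset.sum_add_distrib]
  simp

/-- `squareSubst` is only `K`-linear, but it is compatible with removing a square: raising `m k` by
2 keeps its parity and adds one factor `g k`. -/
lemma squareSubst_sq_mul (k : σ) (p : MvPolynomial σ K) :
    squareSubst g (X k ^ 2 * p) = g k * squareSubst g p := by
  classical
  suffices h : (squareSubst g) ∘ₗ LinearMap.mulLeft K (X k ^ 2) =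
      LinearMap.mulLeft K (g k) ∘ₗ squareSubst g from LinearMap.congr_fun h p
  refine (basisMonomials σ K).ext fun m => ?_
  rw [coe_basisMonomials]
  simp only [LinearMap.comp_apply, LinearMap.mulLeft_apply]
  rw [X_pow_eq_monomial, monomial_mul, mul_one, squareSubst_monomial, squareSubst_monomial,
    ← Finset.mul_prod_erase _ _ (Finset.mem_univ k), ← Finset.mul_prod_erase _ _ (Finset.mem_univ k),
    ← mul_assoc]
  congr 1
  · rw [← mul_assoc, ← pow_succ']
    have h1 : (Finsupp.single k 2 + m : σ →₀ ℕ) k = m k + 2 := by simp [add_comm]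
    rw [h1, Nat.add_div_right _ two_pos, Nat.add_mod_right]
  · refine Finset.prod_congr rfl fun i hi => ?_
    have h1 : (Finsupp.single k 2 + m : σ →₀ ℕ) i = m i := by simp [(Finset.ne_of_mem_erase hi).symm]
    rw [h1]

variable {g} {w : σ → ℕ}

/-- The image of a monomial `m` has leading monomial `m` again. Thus `squareSubst` is the identity
up to smaller weight, and induction on weight makes it bijective. -/
lemma sub_squareSubst_mem (hg : ∀ k, HasLead w (g k) (Finsupp.single k 2)) {j : ℕ}
    {p : MvPolynomial σ K} (hp : p ∈ weightLT K w (j + 1)) :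
    p - squareSubst g p ∈ weightLT K w j := by
  have h : weightLT K w (j + 1) ≤ (weightLT K w j).comap (LinearMap.id - squareSubst g) := by
    rw [weightLT, restrictSupport_eq_span, Submodule.span_le]
    rintro _ ⟨m, hm, rfl⟩
    refine weightLT_mono (Nat.le_of_lt_succ hm) ?_
    rw [LinearMap.sub_apply, LinearMap.id_apply, ← neg_sub, squareSubst_monomial]
    refine neg_mem ?_
    have h1 : HasLead w (∏ k, (g k ^ (m k / 2) * X k ^ (m k % 2)))
        (∑ k, ((m k / 2) • Finsupp.single k 2 + (m k % 2) • Finsupp.single k 1)) :=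
      HasLead.prod _ fun k _ => ((hg k).pow _).mul ((hasLead_monomial w _).pow _)
    have h2 : ∑ k, ((m k / 2) • Finsupp.single k 2 + (m k % 2) • Finsupp.single k 1) = m := by
      conv_rhs => rw [← Finsupp.univ_sum_single m]
      refine Finset.sum_congr rfl fun k _ => ?_
      rw [Finsupp.smul_single, Finsupp.smul_single, ← Finsupp.single_add]
      congr 1
      simp only [smul_eq_mul]
      omega
    rwa [h2] at h1
  exact h hp

lemma squareSubst_injective (hg : ∀ k, HasLead w (g k) (Finsupp.single k 2)) :
    Function.Injective (squareSubst g) := by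
  refine (injective_iff_map_eq_zero _).2 fun p hp => ?_
  have h : ∀ j, p ∈ weightLT K w j → p = 0 := fun j => by
    induction j with
    | zero =>
      intro h
      rw [← support_eq_empty, Finset.eq_empty_iff_forall_notMem]
      exact fun m hm => Nat.not_lt_zero _ (h hm)
    | succ j ih =>
      intro h
      have := sub_squareSubst_mem hg h
      rw [hp, sub_zero] at this
      exact ih this
  obtain ⟨j, hj⟩ := exists_mem_weightLT w p
  exact h j hj

lemma squareSubst_surjective (hg : ∀ k, HasLead w (g k) (Finsupp.single k 2)) :
    Function.Surjective (squareSubst g) := by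
  intro p
  have h : ∀ j, ∀ p ∈ weightLT K w j, ∃ q, squareSubst g q = p := fun j => by
    induction j with
    | zero =>
      intro p h
      refine ⟨0, ?_⟩
      rw [map_zero, eq_comm, ← support_eq_empty, Finset.eq_empty_iff_forall_notMem]
      exact fun m hm => Nat.not_lt_zero _ (h hm)
    | succ j ih =>
      intro p h
      obtain ⟨q, hq⟩ := ih _ (sub_squareSubst_mem hg h)
      exact ⟨p + q, by rw [map_add, hq, add_sub_cancel]⟩
  obtain ⟨j, hj⟩ := exists_mem_weightLT w p
  exact h j p hj

/-- The image of the span `V s` of monomials divisible by at least `s` squares, with multiplicity,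
is an ideal, and multiplication by `g k` sends the image of `V s` into that of `V (s + 1)`. -/
lemma exists_of_mem_pow (hg : ∀ k, HasLead w (g k) (Finsupp.single k 2)) (s : ℕ)
    {p : MvPolynomial σ K} (hp : p ∈ Ideal.span (Set.range g) ^ s) :
    ∃ q ∈ restrictSupport K {m : σ →₀ ℕ | s ≤ ∑ k, m k / 2}, squareSubst g q = p := by
  classical
  let V : ℕ → Submodule K (MvPolynomial σ K) := fun s =>
    restrictSupport K {m : σ →₀ ℕ | s ≤ ∑ k, m k / 2}
  have hsq : ∀ k s, ∀ q ∈ V s, X k ^ 2 * q ∈ V (s + 1) := by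
    intro k s q hq x hx
    rw [X_pow_eq_monomial] at hx
    obtain ⟨a, ha, b, hb, rfl⟩ := Finset.mem_add.1 (support_mul _ _ hx)
    have ha' := Finset.mem_singleton.1 (support_monomial_subset ha)
    have hb' : s ≤ ∑ k, b k / 2 := hq hb
    subst ha'
    rw [Set.mem_ofPred, sum_half_single_add]
    exact Nat.succ_le_succ hb'
  -- The image of `V s` absorbs multiplication: for `s = 0` this is surjectivity, and otherwise each
  -- monomial has a factor `X k ^ 2`, which comes out as `g k` and lowers `s`.
  have hmul : ∀ s, ∀ q ∈ V s, ∀ r, ∃ q' ∈ V s, squareSubst g q' = r * squareSubst g q := by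
    intro s
    induction s with
    | zero =>
      intro q _ r
      obtain ⟨q', hq'⟩ := squareSubst_surjective hg (r * squareSubst g q)
      exact ⟨q', fun _ _ => Nat.zero_le _, hq'⟩
    | succ s ih =>
      intro q hq r
      have h : V (s + 1) ≤ ((V (s + 1)).map (squareSubst g)).comap
          (LinearMap.mulLeft K r ∘ₗ squareSubst g) := by
        refine (restrictSupport_eq_span (R := K) _).le.trans (Submodule.span_le.2 ?_)
        rintro _ ⟨m, hm, rfl⟩
        have h1 : ∃ k, 2 ≤ m k := by
          by_contra! h
          have h2 : ∑ k, m k / 2 = 0 := Finset.sum_eq_zero fun k _ => Nat.div_eq_of_lt (h k)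
          have h3 : s + 1 ≤ ∑ k, m k / 2 := hm
          omega
        obtain ⟨k, hk⟩ := h1
        obtain ⟨b, rfl⟩ : ∃ b, m = Finsupp.single k 2 + b :=
          ⟨m - Finsupp.single k 2, (add_tsub_cancel_of_le (Finsupp.single_le_iff.2 hk)).symm⟩
        have hb : monomial b (1 : K) ∈ V s := by
          refine (monomial_mem_restrictSupport K).2 (Or.inl ?_)
          have h3 : s + 1 ≤ ∑ i, (Finsupp.single k 2 + b : σ →₀ ℕ) i / 2 := hm
          rw [sum_half_single_add] at h3
          exact Nat.le_of_succ_le_succ h3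
        obtain ⟨q', hq', he⟩ := ih _ hb r
        refine ⟨X k ^ 2 * q', hsq k s q' hq', ?_⟩
        have h4 : monomial (Finsupp.single k 2 + b) (1 : K) = X k ^ 2 * monomial b 1 := by
          rw [X_pow_eq_monomial, monomial_mul, mul_one]
        change squareSubst g _ = r * squareSubst g (monomial _ 1)
        rw [h4, squareSubst_sq_mul, squareSubst_sq_mul, he, mul_left_comm]
      exact h hq
  induction s generalizing p with
  | zero =>
    obtain ⟨q, hq⟩ := squareSubst_surjective hg p
    exact ⟨q, fun _ _ => Nat.zero_le _, hq⟩
  | succ s ih =>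
    let Q : Ideal (MvPolynomial σ K) :=
      { (V (s + 1)).map (squareSubst g) with
        smul_mem' := by
          rintro r _ ⟨q, hq, rfl⟩
          obtain ⟨q', h1, h2⟩ := hmul _ q hq r
          exact ⟨q', h1, h2⟩ }
    suffices h : Ideal.span (Set.range g) ^ (s + 1) ≤ Q from h hp
    rw [pow_succ, Ideal.mul_le]
    intro a ha b hb
    obtain ⟨q, hq, rfl⟩ := ih ha
    induction hb using Submodule.span_induction with
    | mem x hx =>
      obtain ⟨k, rfl⟩ := hx
      exact ⟨X k ^ 2 * q, hsq k s q hq, by rw [squareSubst_sq_mul, mul_comm]⟩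
    | zero => rw [mul_zero]; exact zero_mem _
    | add x y _ _ hx hy => rw [mul_add]; exact add_mem hx hy
    | smul r x _ hx => rw [smul_eq_mul, mul_left_comm]; exact Q.mul_mem_left r hx

/-- Powers of `g k` times the product of all variables are not in a high power of the ideal
generated by the polynomials `g k`, if the leading monomials of these are the squares of the
variables. -/
theorem pow_mul_prod_X_notMem (hg : ∀ k, HasLead w (g k) (Finsupp.single k 2)) (k : σ) (s : ℕ) :
    g k ^ s * ∏ i, X i ∉ Ideal.span (Set.range g) ^ (s + 1) := by
  classical
  intro h
  obtain ⟨q, hq, he⟩ := exists_of_mem_pow hg _ h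
  have h1 : ∀ s, squareSubst g (monomial (s • Finsupp.single k 2 + ∑ i, Finsupp.single i 1) 1) =
      g k ^ s * ∏ i, X i := fun s => by
    induction s with
    | zero =>
      rw [zero_nsmul, zero_add, pow_zero, one_mul, squareSubst_monomial]
      refine Finset.prod_congr rfl fun i _ => ?_
      have : (∑ i, Finsupp.single i 1 : σ →₀ ℕ) i = 1 := by
        simp [Finsupp.finsetSum_apply, Finsupp.single_apply]
      rw [this]
      simp
    | succ s ih =>
      rw [succ_nsmul', add_assoc, pow_succ', mul_assoc, ← ih, ← squareSubst_sq_mul,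
        X_pow_eq_monomial, monomial_mul, mul_one]
  rw [← h1] at he
  rw [squareSubst_injective hg he, monomial_mem_restrictSupport] at hq
  have h2 := hq.resolve_right one_ne_zero
  have h3 : ∀ s, ∑ i, (s • Finsupp.single k 2 + ∑ i, Finsupp.single i 1 : σ →₀ ℕ) i / 2 = s :=
      fun s => by
    induction s with
    | zero =>
      refine Finset.sum_eq_zero fun i _ => ?_
      have : (∑ i, Finsupp.single i 1 : σ →₀ ℕ) i = 1 := by
        simp [Finsupp.finsetSum_apply, Finsupp.single_apply]
      rw [zero_nsmul, zero_add, this, Nat.div_eq_of_lt one_lt_two]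
    | succ s ih => rw [succ_nsmul', add_assoc, sum_half_single_add, ih]
  rw [Set.mem_ofPred, h3] at h2
  omega

/-- The variables of `K[X_1, …, X_l]`, extended by `0` to all natural indices. -/
noncomputable def extVar (K : Type*) [Field K] (l : ℕ) : ℕ → MvPolynomial (Fin l) K
  | 0 => 0
  | k + 1 => if h : k < l then X ⟨k, h⟩ else 0

lemma extVar_succ (l : ℕ) (k : Fin l) : extVar K l (k + 1) = X k := by
  simp [extVar]

/-- The variable z_k gets weight k(l + 1 - k), which is strictly concave in k: the weight of z_{k+1}
z_{k-1} is 2 less than that of z_k^2. At both ends this product vanishes. -/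
lemma hasLead_extVar (l : ℕ) (k : Fin l) :
    HasLead (fun i : Fin l => (i + 1 : ℕ) * (l - i))
      (extVar K l (k + 1) * extVar K l (k + 1) - extVar K l (k + 2) * extVar K l k)
      (Finsupp.single k 2) := by
  rw [HasLead, extVar_succ, ← pow_two, X_pow_eq_monomial, sub_sub_cancel_left]
  refine neg_mem ?_
  obtain ⟨k, hk⟩ := k
  rcases k with _ | a
  · simp [extVar]
  by_cases h : a + 2 < l
  · obtain ⟨c, rfl⟩ := Nat.exists_eq_add_of_lt h
    have h1 : extVar K (a + 2 + c + 1) (a + 1 + 2) = X ⟨a + 2, h⟩ := extVar_succ _ ⟨a + 2, h⟩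
    have h2 : extVar K (a + 2 + c + 1) (a + 1) = X ⟨a, by omega⟩ := extVar_succ _ ⟨a, by omega⟩
    change extVar K (a + 2 + c + 1) (a + 1 + 2) * extVar K (a + 2 + c + 1) (a + 1) ∈ _
    rw [h1, h2, X, X, monomial_mul]
    refine monomial_mem_weightLT ?_
    rw [map_add, Finsupp.weight_single, Finsupp.weight_single, Finsupp.weight_single]
    have e1 : a + 2 + c + 1 - (a + 2) = c + 1 := by omega
    have e2 : a + 2 + c + 1 - a = c + 3 := by omega
    have e3 : a + 2 + c + 1 - (a + 1) = c + 2 := by omega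
    simp only [e1, e2, e3, smul_eq_mul]
    ring_nf
    omega
  · have h1 : extVar K l (a + 1 + 2) = 0 := by
      rw [extVar, dif_neg h]
    change extVar K l (a + 1 + 2) * _ ∈ _
    rw [h1, zero_mul]
    exact zero_mem _

end LeadingSquares

/-! ### Existence of minimal graded free resolutions -/

section Resolution

open MvPolynomial

variable {σ K : Type*} [Field K]

/-- The vectors in the graded free module with basis degrees `sh` all of whose homogeneous
components have degrees satisfying `P`. -/
def degPart {r : ℕ} (sh : Fin r → ℕ) (P : ℕ → Prop) : AddSubgroup (Fin r → MvPolynomial σ K) where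
  carrier := {v | ∀ b, ∀ m ∈ (v b).support, P (m.degree + sh b)}
  zero_mem' b m hm := by simp at hm
  add_mem' {v w} hv hw b m hm := by
    classical
    rcases Finset.mem_union.1 (support_add hm) with h | h
    · exact hv b m h
    · exact hw b m h
  neg_mem' {v} hv b m hm := hv b m (by rwa [Pi.neg_apply, support_neg] at hm)

/-- The homogeneous component of degree `e` of a vector in the graded free module with basis
degrees `sh`. -/
noncomputable def component {r : ℕ} (sh : Fin r → ℕ) (e : ℕ) (v : Fin r → MvPolynomial σ K) :
    Fin r → MvPolynomial σ K :=
  fun b => if sh b ≤ e then homogeneousComponent (e - sh b) (v b) else 0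

lemma coeff_component {r : ℕ} (sh : Fin r → ℕ) (e : ℕ) (v : Fin r → MvPolynomial σ K) (b : Fin r)
    (m : σ →₀ ℕ) :
    coeff m (component sh e v b) = if m.degree + sh b = e then coeff m (v b) else 0 := by
  rw [component]
  split_ifs with h1 h2 h2
  · rw [coeff_homogeneousComponent, if_pos (by omega)]
  · rw [coeff_homogeneousComponent, if_neg (by omega)]
  · omega
  · rfl

lemma component_mem {r : ℕ} (sh : Fin r → ℕ) (e : ℕ) (v : Fin r → MvPolynomial σ K) :
    component sh e v ∈ degPart sh (· = e) := fun b m hm => by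
  rw [mem_support_iff, coeff_component] at hm
  by_contra h
  exact hm (if_neg h)

lemma sub_component_mem {r : ℕ} (sh : Fin r → ℕ) (e : ℕ) (v : Fin r → MvPolynomial σ K) :
    v - component sh e v ∈ degPart sh (· ≠ e) := fun b m hm h => by
  rw [mem_support_iff, Pi.sub_apply, coeff_sub, coeff_component, if_pos h, sub_self] at hm
  exact hm rfl

lemma eq_zero_of_mem_degPart {r : ℕ} {sh : Fin r → ℕ} {P : ℕ → Prop}
    {v : Fin r → MvPolynomial σ K} (h : v ∈ degPart sh P) (h' : v ∈ degPart sh fun n => ¬P n) :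
    v = 0 := by
  funext b
  rw [Pi.zero_apply, ← support_eq_empty, Finset.eq_empty_iff_forall_notMem]
  exact fun m hm => h' b m hm (h b m hm)

lemma sum_component {r : ℕ} (sh : Fin r → ℕ) (v : Fin r → MvPolynomial σ K) :
    ∃ B, ∑ e ∈ Finset.range B, component sh e v = v := by
  refine ⟨Finset.univ.sup (fun b => (v b).totalDegree + sh b) + 1, ?_⟩
  funext b
  ext m
  simp only [Finset.sum_apply, coeff_sum, coeff_component, Finset.sum_ite_eq, Finset.mem_range]
  split_ifs with h
  · rfl
  · by_contra hm
    refine h (Nat.lt_succ_of_le (le_trans ?_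
      (Finset.le_sup (f := fun b => (v b).totalDegree + sh b) (Finset.mem_univ b))))
    exact Nat.add_le_add_right (le_totalDegree (mem_support_iff.2 (Ne.symm hm))) _

lemma smul_mem_degPart {r : ℕ} {sh : Fin r → ℕ} {p : MvPolynomial σ K} {k e : ℕ}
    (hp : p.IsHomogeneous k) {v : Fin r → MvPolynomial σ K} (hv : v ∈ degPart sh (· = e)) :
    p • v ∈ degPart sh (· = e + k) := by
  classical
  intro b m hm
  rw [Pi.smul_apply, smul_eq_mul] at hm
  obtain ⟨x, hx, y, hy, rfl⟩ := Finset.mem_add.1 (support_mul _ _ hm)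
  have h1 : y.degree + sh b = e := hv b y hy
  have h2 : x.degree = k := by
    rw [Finsupp.degree_eq_weight_one]
    exact hp (mem_support_iff.1 hx)
  rw [map_add]
  omega

/-- A homomorphism of graded free modules preserves degrees. -/
lemma map_mem_degPart {r r' : ℕ} {sh : Fin r → ℕ} {sh' : Fin r' → ℕ}
    {D : (Fin r' → MvPolynomial σ K) →ₗ[MvPolynomial σ K] (Fin r → MvPolynomial σ K)}
    (hD : ∀ b, D (Pi.single b 1) ∈ degPart sh (· = sh' b)) {P : ℕ → Prop}
    {v : Fin r' → MvPolynomial σ K} (hv : v ∈ degPart sh' P) : D v ∈ degPart sh P := by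
  classical
  rw [D.pi_apply_eq_sum_univ]
  refine sum_mem fun b _ => ?_
  intro a m hm
  rw [Pi.smul_apply, smul_eq_mul] at hm
  obtain ⟨x, hx, y, hy, rfl⟩ := Finset.mem_add.1 (support_mul _ _ hm)
  have h1 := hv b x hx
  have h2 : y.degree + sh a = sh' b := hD b a y (by
    have : (fun j => if b = j then (1 : MvPolynomial σ K) else 0) = Pi.single b 1 := by
      funext j
      simp [Pi.single_apply, eq_comm]
    rwa [this] at hy)
  rw [map_add, add_assoc, h2]
  exact h1

/-- The difference of the two sides lies in degree `e`, and also in the degrees other than `e`. -/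
lemma map_component {r r' : ℕ} {sh : Fin r → ℕ} {sh' : Fin r' → ℕ}
    {D : (Fin r' → MvPolynomial σ K) →ₗ[MvPolynomial σ K] (Fin r → MvPolynomial σ K)}
    (hD : ∀ b, D (Pi.single b 1) ∈ degPart sh (· = sh' b)) (e : ℕ)
    (v : Fin r' → MvPolynomial σ K) : D (component sh' e v) = component sh e (D v) := by
  rw [← sub_eq_zero]
  refine eq_zero_of_mem_degPart (P := (· = e)) (sh := sh)
    (sub_mem (map_mem_degPart hD (component_mem _ _ _)) (component_mem _ _ _)) ?_
  have h : D (component sh' e v) - component sh e (D v) =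
      (D v - component sh e (D v)) - D (v - component sh' e v) := by
    rw [map_sub]
    abel
  rw [h]
  exact sub_mem (sub_component_mem _ _ _) (map_mem_degPart hD (sub_component_mem _ _ _))

lemma component_eq_self {r : ℕ} {sh : Fin r → ℕ} {e : ℕ} {v : Fin r → MvPolynomial σ K}
    (hv : v ∈ degPart sh (· = e)) : component sh e v = v := by
  rw [eq_comm, ← sub_eq_zero]
  exact eq_zero_of_mem_degPart (sub_mem hv (component_mem _ _ _)) (sub_component_mem _ _ _)

/-- A graded submodule of a graded free module, contained in the product of the free module with
the graded maximal ideal. -/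
structure Syzygies (σ K : Type*) [Field K] where
  /-- the rank of the free module -/
  rank : ℕ
  /-- the degrees of the basis vectors -/
  shift : Fin rank → ℕ
  /-- the submodule -/
  module : Submodule (MvPolynomial σ K) (Fin rank → MvPolynomial σ K)
  component_mem : ∀ v ∈ module, ∀ e, component shift e v ∈ module
  constantCoeff_eq_zero : ∀ v ∈ module, ∀ b, constantCoeff (v b) = 0

/-- A minimal graded free cover of a graded submodule of a graded free module. -/
structure MinimalCover (A : Syzygies σ K) where
  /-- the rank of the cover -/
  rank : ℕ
  /-- the degrees of the basis vectors -/
  shift : Fin rank → ℕ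
  /-- the covering map -/
  map : (Fin rank → MvPolynomial σ K) →ₗ[MvPolynomial σ K] (Fin A.rank → MvPolynomial σ K)
  range_map : LinearMap.range map = A.module
  map_single_mem : ∀ b, map (Pi.single b 1) ∈ degPart A.shift (· = shift b)
  constantCoeff_eq_zero : ∀ v, map v = 0 → ∀ b, constantCoeff (v b) = 0

lemma exists_homogeneous_generators [Finite σ] (A : Syzygies σ K) :
    ∃ (r : ℕ) (g : Fin r → Fin A.rank → MvPolynomial σ K),
      (∀ b, ∃ e, g b ∈ degPart A.shift (· = e)) ∧
        Submodule.span (MvPolynomial σ K) (Set.range g) = A.module := by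
  let H : Set (Fin A.rank → MvPolynomial σ K) :=
    {v | v ∈ A.module ∧ ∃ e, v ∈ degPart A.shift (· = e)}
  have hH : Submodule.span (MvPolynomial σ K) H = A.module := by
    refine le_antisymm (Submodule.span_le.2 fun v hv => hv.1) fun v hv => ?_
    obtain ⟨B, hB⟩ := sum_component A.shift v
    rw [← hB]
    exact sum_mem fun e _ => Submodule.subset_span
      ⟨A.component_mem v hv e, e, component_mem _ _ _⟩
  have hfg : (Submodule.span (MvPolynomial σ K) H).FG := IsNoetherian.noetherian _
  obtain ⟨s, hs, he⟩ := Submodule.fg_span_iff_fg_span_finset_subset _ |>.1 hfg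
  refine ⟨s.card, fun b => s.equivFin.symm b, fun b => (hs (s.equivFin.symm b).2).2, ?_⟩
  rw [← hH, he]
  congr 1
  ext v
  constructor
  · rintro ⟨b, rfl⟩
    exact (s.equivFin.symm b).2
  · intro hv
    exact ⟨s.equivFin ⟨v, hv⟩, by simp⟩

/-- Take the least possible number of homogeneous generators. A relation with a nonzero constant
coefficient would make one of them redundant. -/
lemma nonempty_minimalCover [Finite σ] (A : Syzygies σ K) : Nonempty (MinimalCover A) := by
  classical
  have hex := exists_homogeneous_generators A
  obtain ⟨g, hg, hspan⟩ := Nat.find_spec hex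
  have hmin := fun r (hr : r < Nat.find hex) => Nat.find_min hex hr
  generalize Nat.find hex = r at g hg hspan hmin
  choose sh hsh using hg
  have hmap : ∀ b, Fintype.linearCombination (MvPolynomial σ K) g (Pi.single b 1) ∈
      degPart A.shift (· = sh b) := fun b => by
    rw [Fintype.linearCombination_apply_single, one_smul]
    exact hsh b
  refine ⟨⟨r, sh, Fintype.linearCombination (MvPolynomial σ K) g, ?_, hmap, ?_⟩⟩
  · rw [Fintype.range_linearCombination, hspan]
  · intro v hv b
    by_contra hb
    obtain ⟨k, rfl⟩ : ∃ k, r = k + 1 := ⟨r - 1, by have := b.2; omega⟩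
    -- The component of the relation in degree `sh b` is again a relation, and its coefficient at `g
    -- b` is exactly the nonzero constant.
    have h1 := map_component hmap (sh b) v
    rw [hv] at h1
    have h2 : component A.shift (sh b) (0 : Fin A.rank → MvPolynomial σ K) = 0 :=
      component_eq_self (zero_mem _)
    have h3 : component sh (sh b) v b = C (constantCoeff (v b)) := by
      rw [component, if_pos le_rfl, Nat.sub_self, homogeneousComponent_zero]
      rfl
    rw [h2, Fintype.linearCombination_apply, Fin.sum_univ_succAbove _ b, h3,
      add_eq_zero_iff_eq_neg] at h1
    refine hmin k (Nat.lt_succ_self k) ⟨fun j => g (b.succAbove j), fun j => ⟨_, hsh _⟩, ?_⟩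
    rw [← hspan]
    refine le_antisymm (Submodule.span_mono (by rintro _ ⟨j, rfl⟩; exact ⟨_, rfl⟩)) ?_
    rw [Submodule.span_le]
    rintro _ ⟨j, rfl⟩
    rcases Fin.eq_self_or_eq_succAbove b j with rfl | ⟨j, rfl⟩
    · have h4 : g j = (C (constantCoeff (v j))⁻¹ : MvPolynomial σ K) •
          (C (constantCoeff (v j)) : MvPolynomial σ K) • g j := by
        rw [smul_smul, ← C_mul, inv_mul_cancel₀ hb, C_1, one_smul]
      rw [h4, h1]
      exact Submodule.smul_mem _ _ (neg_mem (sum_mem fun i _ =>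
        Submodule.smul_mem _ _ (Submodule.subset_span ⟨i, rfl⟩)))
    · exact Submodule.subset_span ⟨j, rfl⟩

/-- A chosen minimal graded free cover. -/
noncomputable def minimalCover [Finite σ] (A : Syzygies σ K) : MinimalCover A :=
  (nonempty_minimalCover A).some

/-- The kernel of the minimal graded free cover. -/
noncomputable def Syzygies.next [Finite σ] (A : Syzygies σ K) : Syzygies σ K where
  rank := (minimalCover A).rank
  shift := (minimalCover A).shift
  module := LinearMap.ker (minimalCover A).map
  component_mem v hv e := by
    rw [LinearMap.mem_ker] at hv ⊢
    rw [map_component (minimalCover A).map_single_mem, hv]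
    exact component_eq_self (zero_mem _)
  constantCoeff_eq_zero v hv b := (minimalCover A).constantCoeff_eq_zero v hv b

/-- The iterated syzygy modules. -/
noncomputable def Syzygies.iter [Finite σ] (A : Syzygies σ K) : ℕ → Syzygies σ K
  | 0 => A
  | n + 1 => (A.iter n).next

/-- A homogeneous proper ideal as a module of syzygies. -/
noncomputable def idealSyzygies (I : Ideal (MvPolynomial σ K))
    (hI : ∀ p ∈ I, ∀ e, homogeneousComponent e p ∈ I) (hI' : ∀ p ∈ I, constantCoeff p = 0) :
    Syzygies σ K where
  rank := 1
  shift := fun _ => 0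
  module := Submodule.comap (LinearMap.proj 0 : (Fin 1 → MvPolynomial σ K) →ₗ[MvPolynomial σ K] _) I
  component_mem v hv e := by
    rw [Submodule.mem_comap, LinearMap.proj_apply, component, if_pos (Nat.zero_le e)]
    exact hI _ hv _
  constantCoeff_eq_zero v hv b := by
    rw [Fin.fin_one_eq_zero b]
    exact hI' _ hv

/-- A minimal graded free resolution of the quotient by a homogeneous proper ideal. -/
noncomputable def quotientResolution [Finite σ] (I : Ideal (MvPolynomial σ K))
    (hI : ∀ p ∈ I, ∀ e, homogeneousComponent e p ∈ I) (hI' : ∀ p ∈ I, constantCoeff p = 0) :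
    MinimalGradedFreeResolution (σ := σ) (quotientGrading I) where
  rank i := ((idealSyzygies I hI hI').iter i).rank
  shift i := ((idealSyzygies I hI hI').iter i).shift
  d i := (minimalCover ((idealSyzygies I hI hI').iter i)).map
  aug := I.mkQ.comp (LinearMap.proj (0 : Fin 1))
  aug_surjective := by
    refine I.mkQ_surjective.comp fun p => ⟨fun _ => p, rfl⟩
  exact_aug y := by
    change _ ↔ y ∈ LinearMap.range (minimalCover (idealSyzygies I hI hI')).map
    rw [(minimalCover (idealSyzygies I hI hI')).range_map]
    exact Submodule.Quotient.mk_eq_zero I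
  exact_d i y := by
    change _ ↔ y ∈ LinearMap.range (minimalCover ((idealSyzygies I hI hI').iter (i + 1))).map
    rw [(minimalCover ((idealSyzygies I hI hI').iter (i + 1))).range_map]
    rfl
  aug_homogeneous b := by
    refine ⟨1, isHomogeneous_one _ _, ?_⟩
    obtain rfl : b = (0 : Fin 1) := Subsingleton.elim (α := Fin 1) _ _
    change I.mkQ 1 = I.mkQ ((Pi.single (0 : Fin 1) 1 : Fin 1 → MvPolynomial σ K) 0)
    rw [Pi.single_eq_same]
  d_homogeneous i b a m hm :=
    (minimalCover ((idealSyzygies I hI hI').iter i)).map_single_mem b a m hm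
  minimal i b a := ((idealSyzygies I hI hI').iter i).constantCoeff_eq_zero _ (by
    rw [← (minimalCover ((idealSyzygies I hI hI').iter i)).range_map]
    exact LinearMap.mem_range_self _ _) a

end Resolution

/-! ### The Koszul complex on all variables of a polynomial ring -/

section Variables

open MvPolynomial

variable {K : Type*} [Field K]

lemma constantCoeff_extVar (l k : ℕ) : constantCoeff (extVar K l k) = 0 := by
  rcases k with _ | k
  · exact map_zero _
  · rw [extVar]
    split_ifs
    · exact constantCoeff_X _ _
    · exact map_zero _

/-- The ideal generated by the first `n` variables. -/
noncomputable def varIdeal (K : Type*) [Field K] (l n : ℕ) : Ideal (MvPolynomial (Fin l) K) :=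
  Ideal.span (X '' {i : Fin l | (i : ℕ) < n})

lemma varIdeal_zero (l : ℕ) : varIdeal K l 0 = ⊥ := by
  simp [varIdeal]

lemma varIdeal_le_succ (l n : ℕ) : varIdeal K l n ≤ varIdeal K l (n + 1) :=
  Ideal.span_mono (Set.image_mono fun _ hi => Nat.lt_succ_of_lt hi)

lemma extVar_mem_varIdeal (l n : ℕ) : extVar K l (n + 1) ∈ varIdeal K l (n + 1) := by
  rw [extVar]
  split_ifs with h
  · exact Ideal.subset_span ⟨⟨n, h⟩, Nat.lt_succ_self n, rfl⟩
  · exact zero_mem _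

lemma exists_of_mem_varIdeal_succ {l n : ℕ} {p : MvPolynomial (Fin l) K}
    (hp : p ∈ varIdeal K l (n + 1)) : ∃ q ∈ varIdeal K l n, ∃ r, p = q + extVar K l (n + 1) * r := by
  by_cases h : n < l
  · have h1 : {i : Fin l | (i : ℕ) < n + 1} = insert ⟨n, h⟩ {i : Fin l | (i : ℕ) < n} := by
      ext i
      simp [Fin.ext_iff]
      omega
    rw [varIdeal, h1, Set.image_insert_eq, Ideal.mem_span_insert] at hp
    obtain ⟨r, q, hq, rfl⟩ := hp
    refine ⟨q, hq, r, ?_⟩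
    rw [extVar, dif_pos h, add_comm, mul_comm]
  · refine ⟨p, ?_, 0, by rw [mul_zero, add_zero]⟩
    have h1 : {i : Fin l | (i : ℕ) < n + 1} = {i : Fin l | (i : ℕ) < n} := by
      ext i
      have := i.2
      simp only [Set.mem_ofPred]
      omega
    rwa [varIdeal, h1] at hp

/-- Membership is tested on monomials, and multiplication by the next variable does not change the
exponents of the earlier ones. -/
lemma mem_varIdeal_of_extVar_mul_mem {l n : ℕ} (hn : n < l) {p : MvPolynomial (Fin l) K}
    (hp : extVar K l (n + 1) * p ∈ varIdeal K l n) : p ∈ varIdeal K l n := by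
  classical
  rw [extVar, dif_pos hn, varIdeal, mem_ideal_span_X_image] at hp
  rw [varIdeal, mem_ideal_span_X_image]
  intro m hm
  obtain ⟨i, hi, h⟩ := hp (Finsupp.single ⟨n, hn⟩ 1 + m) (by
    rw [mem_support_iff, coeff_X_mul]
    exact mem_support_iff.1 hm)
  refine ⟨i, hi, ?_⟩
  have h1 : i ≠ ⟨n, hn⟩ := by
    rintro rfl
    exact lt_irrefl n hi
  rwa [Finsupp.add_apply, Finsupp.single_eq_of_ne h1, zero_add] at h

lemma constantCoeff_eq_zero_iff_mem_varIdeal {l : ℕ} {p : MvPolynomial (Fin l) K} :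
    constantCoeff p = 0 ↔ p ∈ varIdeal K l l := by
  rw [varIdeal, mem_ideal_span_X_image]
  constructor
  · intro h m hm
    by_contra! hm0
    have h1 : m = 0 := Finsupp.ext fun i => hm0 i i.2
    rw [h1, mem_support_iff] at hm
    exact hm h
  · intro h
    by_contra h0
    obtain ⟨i, _, hi⟩ := h 0 (mem_support_iff.2 h0)
    exact hi rfl

/-- The Koszul complex on all variables is exact in positive exterior degrees. -/
lemma Kos.exists_eq_d {l r : ℕ} {c : Kos (Fin r → MvPolynomial (Fin l) K) l}
    (hc : Kos.d (fun k => extVar K l (k + 1)) l c = 0)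
    (hc' : ∀ a, constantCoeff (Kos.bot l c a) = 0) :
    ∃ b, c = Kos.d (fun k => extVar K l (k + 1)) l b := by
  let N : ℕ → Submodule (MvPolynomial (Fin l) K) (Fin r → MvPolynomial (Fin l) K) := fun n =>
    Submodule.pi Set.univ fun _ => varIdeal K l n
  have hmem : ∀ n v, v ∈ N n ↔ ∀ b, v b ∈ varIdeal K l n := fun n v => by
    simp [N, Submodule.mem_pi]
  have h0 : N 0 = ⊥ := by
    ext v
    rw [hmem, varIdeal_zero, Submodule.mem_bot]
    exact funext_iff.symm
  have hle : ∀ n, N n ≤ N (n + 1) := fun n v hv =>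
    (hmem _ _).2 fun b => varIdeal_le_succ l n ((hmem _ _).1 hv b)
  have ht : ∀ n (a : Fin r → MvPolynomial (Fin l) K), extVar K l (n + 1) • a ∈ N (n + 1) :=
    fun n a => (hmem _ _).2 fun b => Ideal.mul_mem_right _ _ (extVar_mem_varIdeal l n)
  have hN : ∀ n, ∀ a ∈ N (n + 1), ∃ b ∈ N n, ∃ c, a = b + extVar K l (n + 1) • c := by
    intro n a ha
    choose q hq x hx using fun b => exists_of_mem_varIdeal_succ ((hmem _ _).1 ha b)
    exact ⟨q, (hmem _ _).2 hq, x, funext hx⟩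
  obtain ⟨b, a, rfl⟩ := Kos.exists_eq_d_add_incl (t := fun k => extVar K l (k + 1)) h0 hle ht hN l
    (fun n hn a ha => (hmem _ _).2 fun b =>
      mem_varIdeal_of_extVar_mul_mem hn ((hmem _ _).1 ha b)) c hc
  have ha : a ∈ N l := by
    refine (hmem _ _).2 fun j => constantCoeff_eq_zero_iff_mem_varIdeal.1 ?_
    have h1 := hc' j
    have h2 := constantCoeff_eq_zero_iff_mem_varIdeal.2
      ((hmem _ _).1 (Kos.bot_d_mem (t := fun k => extVar K l (k + 1)) hle ht l b) j)
    rwa [map_add, Kos.bot_incl, Pi.add_apply, map_add, h2, zero_add] at h1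
  obtain ⟨b', hb'⟩ := Kos.exists_d_eq_incl (t := fun k => extVar K l (k + 1)) h0 hN l a ha
  exact ⟨b + b', by rw [map_add, hb']⟩

end Variables

/-! ### Base change of maps of free modules -/

section BaseChange

variable {S R : Type*} [CommRing S] [CommRing R] (φ : S →+* R)

/-- Entrywise application of a ring homomorphism to a vector. -/
def mapVec (r : ℕ) : (Fin r → S) →+ (Fin r → R) where
  toFun v b := φ (v b)
  map_zero' := funext fun _ => map_zero φ
  map_add' _ _ := funext fun _ => map_add φ _ _

lemma mapVec_apply {r : ℕ} (v : Fin r → S) (b : Fin r) : mapVec φ r v b = φ (v b) := rfl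

lemma mapVec_smul {r : ℕ} (x : S) (v : Fin r → S) :
    mapVec φ r (x • v) = φ x • mapVec φ r v :=
  funext fun _ => map_mul φ _ _

/-- The base change of a homomorphism of free modules. -/
def baseChange {r r' : ℕ} (D : (Fin r' → S) →ₗ[S] (Fin r → S)) : (Fin r' → R) →ₗ[R] (Fin r → R) :=
  Fintype.linearCombination R fun b => mapVec φ r (D (Pi.single b 1))

lemma baseChange_mapVec {r r' : ℕ} (D : (Fin r' → S) →ₗ[S] (Fin r → S)) (v : Fin r' → S) :
    baseChange φ D (mapVec φ r' v) = mapVec φ r (D v) := by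
  have h : v = ∑ b, v b • (Pi.single b 1 : Fin r' → S) := pi_eq_sum_univ' v
  conv_rhs => rw [h, map_sum, map_sum]
  rw [baseChange, Fintype.linearCombination_apply]
  refine Finset.sum_congr rfl fun b _ => ?_
  rw [LinearMap.map_smul, mapVec_smul, mapVec_apply]

lemma baseChange_baseChange {r r' r'' : ℕ} {D : (Fin r' → S) →ₗ[S] (Fin r → S)}
    {D' : (Fin r'' → S) →ₗ[S] (Fin r' → S)} (h : ∀ v, D (D' v) = 0) (v : Fin r'' → R) :
    baseChange φ D (baseChange φ D' v) = 0 := by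
  conv_lhs => rw [baseChange.eq_1 φ D', Fintype.linearCombination_apply, map_sum]
  refine Finset.sum_eq_zero fun b _ => ?_
  rw [LinearMap.map_smul, baseChange_mapVec, h, map_zero, smul_zero]

lemma baseChange_apply_mem {r r' : ℕ} {D : (Fin r' → S) →ₗ[S] (Fin r → S)} {I : Ideal S} {a : Fin r}
    (h : ∀ b, D (Pi.single b 1) a ∈ I) (v : Fin r' → R) : baseChange φ D v a ∈ I.map φ := by
  rw [baseChange, Fintype.linearCombination_apply, Finset.sum_apply]
  exact sum_mem fun b _ => Ideal.mul_mem_left _ _ (Ideal.mem_map_of_mem φ (h b))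

end BaseChange

/-! ### Zigzag between a minimal resolution and the Koszul complex -/

section Zigzag

open MvPolynomial

variable {σ K M : Type*} [Field K] [AddCommGroup M] [Module K M] [Module (MvPolynomial σ K) M]
  {𝓜 : ℕ → Submodule K M}

lemma MinimalGradedFreeResolution.d_single_mem (F : MinimalGradedFreeResolution (σ := σ) 𝓜) (i : ℕ)
    (b : Fin (F.rank (i + 1))) :
    F.d i (Pi.single b 1) ∈ degPart (F.shift i) (· = F.shift (i + 1) b) :=
  fun a m hm => F.d_homogeneous i b a m hm

/-- The comparison of a minimal graded free resolution with the Koszul complex: a Koszul chain of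
exterior degree `h` with coefficients in `F_i`, whose Koszul boundary comes from `F_{i+1}`, gives
rise to a basis vector of `F_{i+h}`, unless it is homologous to zero over the polynomial ring in
fewer variables. -/
theorem exists_shift_eq_or_exists_eq_add (F : MinimalGradedFreeResolution (σ := σ) 𝓜) {l : ℕ}
    {φ : MvPolynomial σ K →+* MvPolynomial (Fin l) K}
    (hφ : ∀ p, constantCoeff (φ p) = constantCoeff p) {t : ℕ → MvPolynomial σ K}
    (ht : ∀ i, (t i).IsHomogeneous 1) (ht0 : φ (t 0) = 0)
    (htk : ∀ k, φ (t (k + 1)) = extVar K l (k + 1)) :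
    ∀ (h i e : ℕ) (c : Kos (Fin (F.rank i) → MvPolynomial σ K) (l + 1)),
      Kos.Gr (degPart (F.shift i) (· = e)) (l + 1) h c →
      (∃ y, Kos.map (F.d i).toAddMonoidHom (l + 1) y = Kos.d t (l + 1) c) →
      (∃ b, F.shift (i + h) b = e + h) ∨
        ∃ b' b, Kos.drop (mapVec φ (F.rank i)) l c =
          Kos.map (baseChange φ (F.d i)).toAddMonoidHom l b' +
            Kos.d (fun k => extVar K l (k + 1)) l b := by
  have hsm : ∀ r : ℕ, ∀ (x : MvPolynomial σ K) (v : Fin r → MvPolynomial σ K),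
      mapVec φ r (x • v) = φ x • mapVec φ r v := fun r => mapVec_smul φ
  have htk' : (fun k => φ (t (k + 1))) = fun k => extVar K l (k + 1) := funext htk
  have hid : ∀ i, ∀ (x : MvPolynomial σ K) (v : Fin (F.rank (i + 1)) → MvPolynomial σ K),
      (F.d i).toAddMonoidHom (x • v) = RingHom.id _ x • (F.d i).toAddMonoidHom v :=
    fun i x v => (F.d i).map_smul x v
  have hbc : ∀ i, ∀ (x : MvPolynomial (Fin l) K) (v : Fin (F.rank (i + 1)) → MvPolynomial (Fin l) K),
      (baseChange φ (F.d i)).toAddMonoidHom (x • v) =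
        RingHom.id _ x • (baseChange φ (F.d i)).toAddMonoidHom v :=
    fun i x v => (baseChange φ (F.d i)).map_smul x v
  intro h
  induction h with
  | zero =>
    intro i e c hc _
    by_cases hb : ∃ b, F.shift (i + 0) b = e + 0
    · exact Or.inl hb
    right
    obtain ⟨h1, h2⟩ := Kos.Gr.eq_incl hc
    have h3 : Kos.d (fun k => extVar K l (k + 1)) l (Kos.drop (mapVec φ (F.rank i)) l c) = 0 := by
      rw [h1, Kos.drop_incl, Kos.d_incl]
    -- A nonzero constant term at `a` would force the basis vector `a` to have degree `e`, which is
    -- excluded.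
    obtain ⟨b, hb'⟩ := Kos.exists_eq_d h3 fun a => by
      rw [Kos.bot_drop, mapVec_apply, hφ]
      by_contra h0
      have := h2 a 0 (mem_support_iff.2 h0)
      rw [map_zero, zero_add] at this
      exact hb ⟨a, this⟩
    exact ⟨0, b, by rw [map_zero, zero_add, hb']⟩
  | succ h ih =>
    intro i e c hc ⟨y, hy⟩
    have hdc : Kos.Gr (degPart (F.shift i) (· = e + 1)) (l + 1) h (Kos.d t (l + 1) c) :=
      Kos.Gr.d (fun k _ ha => smul_mem_degPart (ht k) ha) hc
    rw [← hy] at hdc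
    -- Replace `y` by a lift `c'` of the boundary of `c` that is homogeneous in both gradings. The
    -- boundary of `c'` is killed by `F.d i`, so exactness allows the induction hypothesis for `c'`.
    obtain ⟨c', hc', hcc'⟩ := Kos.Gr.exists_lift
      (P := degPart (F.shift (i + 1)) (· = e + 1)) (fun a ha =>
        ⟨component (F.shift (i + 1)) (e + 1) a, component_mem _ _ _, by
          change F.d i _ = F.d i a
          rw [map_component (F.d_single_mem i)]
          exact component_eq_self ha⟩) hdc
    rw [hy] at hcc'
    have hz : Kos.map (F.d i).toAddMonoidHom (l + 1) (Kos.d t (l + 1) c') = 0 := by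
      have h1 := Kos.map_d (hid i) t (l + 1) c'
      rw [h1, hcc']
      exact Kos.d_d t _ _
    obtain ⟨y', hy'⟩ := Kos.map_exact (f := (F.d (i + 1)).toAddMonoidHom)
      (fun b hb => (F.exact_d i b).1 hb) (l + 1) _ hz
    rcases ih (i + 1) (e + 1) c' hc' ⟨y', hy'⟩ with ⟨b, hb⟩ | ⟨b', b, hb⟩
    · left
      have h1 : i + 1 + h = i + (h + 1) := by omega
      rw [← h1]
      exact ⟨b, by rw [hb]; omega⟩
    right
    set δ := Kos.map (baseChange φ (F.d i)).toAddMonoidHom l with hδ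
    -- After specialization, `δ` applied to `c'` is the boundary of `c` by `h1`, and the boundary of
    -- `δ b` by `h2`. Hence `c` and `δ b` differ by a cycle.
    have h1 : δ (Kos.drop (mapVec φ (F.rank (i + 1))) l c') =
        Kos.drop (mapVec φ (F.rank i)) l (Kos.map (F.d i).toAddMonoidHom (l + 1) c') :=
      (Kos.drop_map (fun a => (baseChange_mapVec φ (F.d i) a).symm) l c').symm
    have h2 : δ (Kos.drop (mapVec φ (F.rank (i + 1))) l c') =
        Kos.d (fun k => extVar K l (k + 1)) l (δ b) := by
      have h3 : (baseChange φ (F.d i)).toAddMonoidHom.comp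
          (baseChange φ (F.d (i + 1))).toAddMonoidHom = 0 := by
        refine AddMonoidHom.ext fun v => ?_
        exact baseChange_baseChange φ (fun v => (F.exact_d i _).2 ⟨v, rfl⟩) v
      rw [hb, map_add, hδ, Kos.map_map, h3, Kos.map_zero_hom, zero_add]
      exact Kos.map_d (hbc i) _ l b
    have h4 : Kos.d (fun k => extVar K l (k + 1)) l
        (Kos.drop (mapVec φ (F.rank i)) l c - δ b) = 0 := by
      rw [map_sub, ← h2, h1, hcc', Kos.drop_d (hsm _) t ht0, htk', sub_self]
    -- The cycle has no constant terms in exterior degree 0: `c` has positive exterior degree, and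
    -- the entries of `F.d i` lie in the maximal ideal by minimality.
    obtain ⟨b'', hb''⟩ := Kos.exists_eq_d h4 fun a => by
      rw [map_sub, Pi.sub_apply, Kos.bot_drop, Kos.Gr.bot_eq_zero hc, map_zero, Pi.zero_apply,
        zero_sub, map_neg, neg_eq_zero, hδ, Kos.bot_map]
      have h5 := baseChange_apply_mem φ (D := F.d i) (I := RingHom.ker constantCoeff) (a := a)
        (fun b => F.minimal i b a) (Kos.bot l b)
      have h6 : (RingHom.ker constantCoeff).map φ ≤
          RingHom.ker (constantCoeff (σ := Fin l) (R := K)) :=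
        Ideal.map_le_iff_le_comap.2 fun p hp => (hφ p).trans hp
      exact h6 h5
    exact ⟨b, b'', by rw [← hb'', add_sub_cancel]⟩

end Zigzag

/-! ### Powers of binomial edge ideals and induced paths -/

section Power

open MvPolynomial

attribute [local instance] MvPolynomial.gradedAlgebra

variable {K : Type*} [Field K]

lemma le_regQuotient {σ : Type*} {I : Ideal (MvPolynomial σ K)}
    (F : MinimalGradedFreeResolution (σ := σ) (quotientGrading I)) {i j : ℕ} {r : ℝ}
    (h : ∃ b, F.shift i b = j) (hr : r = j - i) : (r : EReal) ≤ regQuotient I := by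
  obtain ⟨b, hb⟩ := h
  refine le_sSup ⟨F, i, j, ?_, by rw [hr]⟩
  exact Finset.card_ne_zero_of_mem (Finset.mem_filter.2 ⟨Finset.mem_univ b, hb⟩)

lemma constantCoeff_eq_zero_of_mem_binomialEdgeIdeal {n : ℕ} {G : SimpleGraph (Fin n)}
    {p : PolyRing K n} (hp : p ∈ binomialEdgeIdeal K G) : constantCoeff p = 0 := by
  have h : binomialEdgeIdeal K G ≤ RingHom.ker constantCoeff := by
    refine Ideal.span_le.2 ?_
    rintro _ ⟨i, j, _, _, rfl⟩
    simp [RingHom.mem_ker]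
  exact h hp

lemma isHomogeneous_binomial {n : ℕ} (i j : Fin n) :
    (X (Sum.inl i) * X (Sum.inr j) - X (Sum.inl j) * X (Sum.inr i) : PolyRing K n).IsHomogeneous 2 :=
  ((isHomogeneous_X _ _).mul (isHomogeneous_X _ _)).sub
    ((isHomogeneous_X _ _).mul (isHomogeneous_X _ _))

lemma homogeneousComponent_mem_pow {n : ℕ} {G : SimpleGraph (Fin n)} {s : ℕ} {p : PolyRing K n}
    (hp : p ∈ binomialEdgeIdeal K G ^ s) (e : ℕ) :
    homogeneousComponent e p ∈ binomialEdgeIdeal K G ^ s := by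
  have h1 : (binomialEdgeIdeal K G).IsHomogeneous (homogeneousSubmodule (Fin n ⊕ Fin n) K) := by
    refine Ideal.homogeneous_span _ _ ?_
    rintro _ ⟨i, j, _, _, rfl⟩
    exact ⟨2, isHomogeneous_binomial i j⟩
  have h2 : ∀ s, (binomialEdgeIdeal K G ^ s).IsHomogeneous
      (homogeneousSubmodule (Fin n ⊕ Fin n) K) := fun s => by
    induction s with
    | zero => rw [pow_zero, Ideal.one_eq_top]; exact Ideal.IsHomogeneous.top _
    | succ s ih => rw [pow_succ]; exact ih.mul h1
  exact homogeneousComponent_mem_of_mem (h2 s) hp e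

lemma constantCoeff_eq_zero_of_mem_pow {n : ℕ} {G : SimpleGraph (Fin n)} {s : ℕ} (hs : 1 ≤ s)
    {p : PolyRing K n} (hp : p ∈ binomialEdgeIdeal K G ^ s) : constantCoeff p = 0 :=
  constantCoeff_eq_zero_of_mem_binomialEdgeIdeal (Ideal.pow_le_self (by omega) hp)

/-- The minimal graded free resolution of `S / J_G ^ s`. -/
noncomputable def powerResolution (K : Type*) [Field K] {n : ℕ} (G : SimpleGraph (Fin n)) {s : ℕ}
    (hs : 1 ≤ s) : MinimalGradedFreeResolution (σ := Fin n ⊕ Fin n)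
      (quotientGrading (binomialEdgeIdeal K G ^ s)) :=
  quotientResolution _ (fun _ hp e => homogeneousComponent_mem_pow hp e)
    fun _ hp => constantCoeff_eq_zero_of_mem_pow hs hp

lemma binomial_mem {n : ℕ} {G : SimpleGraph (Fin n)} {i j : Fin n} (h : G.Adj i j) :
    (X (Sum.inl i) * X (Sum.inr j) - X (Sum.inl j) * X (Sum.inr i) : PolyRing K n) ∈
      binomialEdgeIdeal K G := by
  rcases lt_or_gt_of_ne h.ne with hij | hij
  · exact Ideal.subset_span ⟨i, j, hij, h, rfl⟩
  · rw [← neg_sub]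
    exact neg_mem (Ideal.subset_span ⟨j, i, hij, h.symm, rfl⟩)

variable {n l : ℕ} {G : SimpleGraph (Fin n)}

/-- The specialization attached to an induced path: it maps `x` at the `k`-th vertex of the path
to the variable `z_{k+1}` and `y` to `z_k`, where `z_0 = z_{l+1} = 0`, and all variables outside of
the path to `0`. -/
noncomputable def specialize (K : Type*) [Field K] (v : Fin (l + 1) → Fin n) :
    PolyRing K n →ₐ[K] MvPolynomial (Fin l) K :=
  aeval (Sum.elim (Function.extend v (fun k => extVar K l (k + 1)) 0)
    (Function.extend v (fun k => extVar K l k) 0))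

section Specialize

variable {v : Fin (l + 1) → Fin n}

lemma specialize_inl (hv : Function.Injective v) (k : Fin (l + 1)) :
    specialize K v (X (Sum.inl (v k))) = extVar K l (k + 1) := by
  rw [specialize, aeval_X, Sum.elim_inl, hv.extend_apply]

lemma specialize_inr (hv : Function.Injective v) (k : Fin (l + 1)) :
    specialize K v (X (Sum.inr (v k))) = extVar K l k := by
  rw [specialize, aeval_X, Sum.elim_inr, hv.extend_apply]

lemma specialize_inl_of_notMem {i : Fin n} (hi : ¬∃ k, v k = i) :
    specialize K v (X (Sum.inl i)) = 0 := by
  rw [specialize, aeval_X, Sum.elim_inl, Function.extend_apply' _ _ _ hi, Pi.zero_apply]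

lemma specialize_inr_of_notMem {i : Fin n} (hi : ¬∃ k, v k = i) :
    specialize K v (X (Sum.inr i)) = 0 := by
  rw [specialize, aeval_X, Sum.elim_inr, Function.extend_apply' _ _ _ hi, Pi.zero_apply]

lemma constantCoeff_specialize (hv : Function.Injective v) (p : PolyRing K n) :
    constantCoeff (specialize K v p) = constantCoeff p := by
  have h : (constantCoeff (σ := Fin l) (R := K)).comp (specialize K v).toRingHom =
      constantCoeff := by
    refine ringHom_ext (fun c => ?_) fun i => ?_
    · simp [specialize]
    · rw [constantCoeff_X]
      change constantCoeff (specialize K v (X i)) = 0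
      rcases i with i | i
      · by_cases hi : ∃ k, v k = i
        · obtain ⟨k, rfl⟩ := hi
          rw [specialize_inl hv, constantCoeff_extVar]
        · rw [specialize_inl_of_notMem hi, map_zero]
      · by_cases hi : ∃ k, v k = i
        · obtain ⟨k, rfl⟩ := hi
          rw [specialize_inr hv, constantCoeff_extVar]
        · rw [specialize_inr_of_notMem hi, map_zero]
  exact RingHom.congr_fun h p

end Specialize

/-- The images of the generators of the binomial edge ideal of a path. -/
noncomputable def pathImage (K : Type*) [Field K] (l : ℕ) (k : Fin l) : MvPolynomial (Fin l) K :=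
  extVar K l (k + 1) * extVar K l (k + 1) - extVar K l (k + 2) * extVar K l k

/-- As the path is induced, an edge of `G` between two of its vertices is an edge of the path and
gives some `pathImage` up to sign. Every other generator has an endpoint off the path and maps to 0.
-/
lemma map_specialize_le (v : SimpleGraph.pathGraph (l + 1) ↪g G) :
    (binomialEdgeIdeal K G).map (specialize K v).toRingHom ≤
      Ideal.span (Set.range (pathImage K l)) := by
  have hv := v.injective
  have key : ∀ a b : Fin (l + 1), (a : ℕ) + 1 = b →
      specialize K v (X (Sum.inl (v a)) * X (Sum.inr (v b)) -
        X (Sum.inl (v b)) * X (Sum.inr (v a))) ∈ Ideal.span (Set.range (pathImage K l)) := by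
    intro a b hab
    refine Ideal.subset_span ⟨⟨a, by omega⟩, ?_⟩
    rw [map_sub, map_mul, map_mul, specialize_inl hv, specialize_inr hv, specialize_inl hv,
      specialize_inr hv, ← hab]
    rfl
  rw [Ideal.map_le_iff_le_comap]
  refine Ideal.span_le.2 ?_
  rintro _ ⟨i, j, _, hij, rfl⟩
  change specialize K v _ ∈ Ideal.span (Set.range (pathImage K l))
  by_cases hi : ∃ k, v k = i
  · by_cases hj : ∃ k, v k = j
    · obtain ⟨a, rfl⟩ := hi
      obtain ⟨b, rfl⟩ := hj
      rcases SimpleGraph.pathGraph_adj.1 (v.map_adj_iff.1 hij) with hab | hab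
      · exact key a b hab
      · rw [← neg_sub, map_neg]
        exact neg_mem (key b a hab)
    · rw [map_sub, map_mul, map_mul, specialize_inl_of_notMem hj,
        specialize_inr_of_notMem hj, mul_zero, zero_mul, sub_zero]
      exact zero_mem _
  · rw [map_sub, map_mul, map_mul, specialize_inl_of_notMem hi,
      specialize_inr_of_notMem hi, mul_zero, zero_mul, sub_zero]
    exact zero_mem _

/-- An induced path with `l ≥ 1` edges gives a nonzero Betti number `β_{l, 2(l + s)}` of
`S / J_G ^ (s + 1)`. -/
theorem exists_shift_eq (v : SimpleGraph.pathGraph (l + 1) ↪g G) (hl : 0 < l) (s : ℕ) :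
    ∃ b, (powerResolution K G (Nat.succ_pos s)).shift l b = 2 * s + l + l := by
  have hv := v.injective
  set F := powerResolution K G (Nat.succ_pos s)
  let φ : PolyRing K n →+* MvPolynomial (Fin l) K := (specialize K v).toRingHom
  let x : ℕ → PolyRing K n := fun k => if h : k < l + 1 then X (Sum.inl (v ⟨k, h⟩)) else 0
  let t : ℕ → PolyRing K n := fun k => if h : k < l + 1 then X (Sum.inr (v ⟨k, h⟩)) else 0
  -- The coefficients of the vectors `x j • e_{j+1} - x (j + 1) • e_j`, whose boundaries are the
  -- binomials `f j`.
  let a : ℕ → ℕ → PolyRing K n := fun j i =>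
    if i = j + 1 then x j else if i = j then -x (j + 1) else 0
  let f : ℕ → PolyRing K n := fun j => x j * t (j + 1) - x (j + 1) * t j
  have hx1 : ∀ k, (x k).IsHomogeneous 1 := fun k => by
    simp only [x]
    split_ifs
    · exact isHomogeneous_X _ _
    · exact isHomogeneous_zero _ _ _
  have ht1 : ∀ k, (t k).IsHomogeneous 1 := fun k => by
    simp only [t]
    split_ifs
    · exact isHomogeneous_X _ _
    · exact isHomogeneous_zero _ _ _
  have hφt : ∀ k, φ (t k) = extVar K l k := fun k => by
    simp only [t]
    split_ifs with h
    · exact specialize_inr hv ⟨k, h⟩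
    · obtain ⟨k, rfl⟩ : ∃ j, k = j + 1 := ⟨k - 1, by omega⟩
      rw [map_zero, extVar, dif_neg (by omega)]
  have hφx : ∀ k, φ (x k) = extVar K l (k + 1) := fun k => by
    simp only [x]
    split_ifs with h
    · exact specialize_inl hv ⟨k, h⟩
    · rw [map_zero, extVar, dif_neg (by omega)]
  have hf : ∀ j < l, f j ∈ binomialEdgeIdeal K G := fun j hj => by
    have h1 : j < l + 1 := by omega
    have h2 : j + 1 < l + 1 := by omega
    simp only [f, x, t, dif_pos h1, dif_pos h2]
    exact binomial_mem (v.map_adj_iff.2 (SimpleGraph.pathGraph_adj.2 (Or.inl rfl)))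
  have hfh : ∀ j, (f j).IsHomogeneous 2 := fun j =>
    ((hx1 _).mul (ht1 _)).sub ((hx1 _).mul (ht1 _))
  have haf : ∀ j < l, ∑ i ∈ Finset.range (l + 1), a j i * t i = f j := fun j hj => by
    have h1 : ∀ i, a j i * t i =
        (if i = j + 1 then x j * t (j + 1) else 0) + if i = j then -x (j + 1) * t j else 0 := by
      intro i
      simp only [a]
      rcases eq_or_ne i (j + 1) with rfl | h1
      · simp
      · rcases eq_or_ne i j with rfl | h2
        · simp
        · simp [h1, h2]
    rw [Finset.sum_congr rfl fun i _ => h1 i, Finset.sum_add_distrib, Finset.sum_ite_eq',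
      Finset.sum_ite_eq', if_pos (Finset.mem_range.2 (by omega)),
      if_pos (Finset.mem_range.2 (by omega))]
    simp only [f]
    ring
  let u : Fin (F.rank 0) → PolyRing K n := fun _ => f 0 ^ s
  have hu : u ∈ degPart (F.shift 0) (· = 2 * s) := fun b m hm => by
    have h1 : F.shift 0 b = 0 := rfl
    have h2 := (hfh 0).pow s (mem_support_iff.1 hm)
    rw [h1, add_zero, Finsupp.degree_eq_weight_one]
    exact h2
  have haug : ∀ j < l, f j • F.aug u = 0 := fun j hj => by
    rw [← LinearMap.map_smul]
    refine (Submodule.Quotient.mk_eq_zero _).2 ?_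
    change f j * f 0 ^ s ∈ _
    rw [mul_comm, pow_succ]
    exact Ideal.mul_mem_mul (Ideal.pow_mem_pow (hf 0 hl) s) (hf j hj)
  have haugs : ∀ (r : PolyRing K n) (w : Fin (F.rank 0) → PolyRing K n),
      F.aug.toAddMonoidHom (r • w) = RingHom.id _ r • F.aug.toAddMonoidHom w :=
    fun r w => F.aug.map_smul r w
  have hgr : Kos.Gr (degPart (F.shift 0) (· = 2 * s + l)) (l + 1) l
      (Kos.wedges a (l + 1) u l) := by
    refine Kos.Gr.wedges (P := fun e => degPart (F.shift 0) (· = e)) (fun j i e w hw => ?_) hu l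
    refine smul_mem_degPart ?_ hw
    simp only [a]
    split_ifs
    · exact hx1 _
    · exact (hx1 _).neg
    · exact isHomogeneous_zero _ _ _
  have hlift : ∃ y, Kos.map (F.d 0).toAddMonoidHom (l + 1) y =
      Kos.d t (l + 1) (Kos.wedges a (l + 1) u l) := by
    refine Kos.map_exact (f := (F.d 0).toAddMonoidHom) (g := F.aug.toAddMonoidHom)
      (fun b hb => (F.exact_aug b).1 hb) _ _ ?_
    have h1 := Kos.map_d haugs t (l + 1) (Kos.wedges a (l + 1) u l)
    rw [h1, Kos.map_wedges haugs]
    refine Kos.d_wedges fun j hj => ?_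
    change (∑ i ∈ Finset.range (l + 1), a j i * t i) • F.aug u = 0
    rw [haf j hj, haug j hj]
  rcases exists_shift_eq_or_exists_eq_add F (φ := φ) (constantCoeff_specialize hv) ht1
    (hφt 0) (fun k => hφt (k + 1)) l 0 (2 * s + l) _ hgr hlift with h | ⟨b', b, hb⟩
  · rwa [zero_add] at h
  exfalso
  -- Once `e_0` is dropped, the coefficient matrix is triangular with diagonal z_1, …, z_l, and the
  -- top coefficient of the other side comes from the image of `F.d 0`, which is the ideal power.
  have h1 := congrArg (Kos.top l) hb
  rw [map_add, Kos.top_map, Kos.top_d, add_zero, Kos.drop_wedges (mapVec_smul φ), Kos.top_wedges]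
    at h1
  · have h2 := congrFun h1 (0 : Fin 1)
    have h3 : baseChange φ (F.d 0) (Kos.top l b') (0 : Fin 1) ∈
        (binomialEdgeIdeal K G ^ (s + 1)).map φ := by
      refine baseChange_apply_mem φ (fun b => ?_) _
      exact (Submodule.Quotient.mk_eq_zero _).1 ((F.exact_aug (F.d 0 (Pi.single b 1))).2 ⟨_, rfl⟩)
    have h4 : (binomialEdgeIdeal K G ^ (s + 1)).map φ ≤
        Ideal.span (Set.range (pathImage K l)) ^ (s + 1) := by
      rw [Ideal.map_pow]
      exact Ideal.pow_right_mono (map_specialize_le v) _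
    have h5 : (∏ i ∈ Finset.range l, φ (a i (i + 1))) * φ (f 0 ^ s) =
        pathImage K l ⟨0, hl⟩ ^ s * ∏ i, X i := by
      have h6 : ∀ i, φ (a i (i + 1)) = extVar K l (i + 1) := fun i => by
        simp only [a, if_true, hφx]
      rw [mul_comm, map_pow, Finset.prod_congr rfl fun i _ => h6 i, Finset.prod_range]
      congr 2
      · simp only [f, map_sub, map_mul, hφx, hφt]
        rfl
      · exact funext fun i => extVar_succ l i
    refine pow_mul_prod_X_notMem (hasLead_extVar (K := K) l) ⟨0, hl⟩ s ?_
    have h7 := h4 h3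
    have h8 : (∏ i ∈ Finset.range l, φ (a i (i + 1))) * φ (f 0 ^ s) =
        baseChange φ (F.d 0) (Kos.top l b') (0 : Fin 1) := h2
    rw [← h8, h5] at h7
    exact h7
  · intro j i hij
    have h2 : i + 1 ≠ j + 1 := by omega
    have h3 : i + 1 ≠ j := by omega
    simp only [a, if_neg h2, if_neg h3, map_zero]

end Power

/-! ### Longest induced paths and the final bound -/

lemma nonempty_pathGraph_embedding {n : ℕ} (G : SimpleGraph (Fin n)) [Nonempty (Fin n)] :
    Nonempty (SimpleGraph.pathGraph (longestInducedPath G + 1) ↪g G) := by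
  refine Nat.sSup_mem (s := {k : ℕ | Nonempty (SimpleGraph.pathGraph (k + 1) ↪g G)}) ?_ ?_
  · obtain ⟨i⟩ := ‹Nonempty (Fin n)›
    refine ⟨0, ⟨⟨⟨fun _ => i, fun a b _ => Subsingleton.elim (α := Fin 1) a b⟩, ?_⟩⟩⟩
    intro a b
    obtain rfl := Subsingleton.elim (α := Fin 1) a b
    simp
  · refine ⟨n, ?_⟩
    rintro k ⟨v⟩
    have := Fintype.card_le_of_injective v v.injective
    simp only [Fintype.card_fin] at this
    omega

/-- Connectedness provides an edge, which is an induced path of length 1. -/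
lemma longestInducedPath_pos {n : ℕ} {G : SimpleGraph (Fin n)} (hG : G.Connected) (hn : 2 ≤ n) :
    0 < longestInducedPath G := by
  have : Nontrivial (Fin n) := Fin.nontrivial_iff_two_le.2 hn
  obtain ⟨j, hj⟩ := hG.preconnected.exists_adj_of_nontrivial ⟨0, by omega⟩
  refine Nat.lt_of_lt_of_le Nat.zero_lt_one (le_csSup ⟨n, ?_⟩ ?_)
  · rintro k ⟨v⟩
    have := Fintype.card_le_of_injective v v.injective
    simp only [Fintype.card_fin] at this
    omega
  · refine ⟨⟨⟨![⟨0, by omega⟩, j], ?_⟩, ?_⟩⟩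
    · intro a b h
      fin_cases a <;> fin_cases b <;> simp_all [hj.ne, hj.ne']
    · intro a b
      rw [SimpleGraph.pathGraph_adj]
      fin_cases a <;> fin_cases b
      · simp
      · exact iff_of_true hj (Or.inl rfl)
      · exact iff_of_true hj.symm (Or.inr rfl)
      · simp

end BinomialEdge

theorem mainTheorem6 (K : Type*) [Field K] (n : ℕ) (G : SimpleGraph (Fin n)) (hG : G.Connected)
    (s : ℕ) (hs : 1 ≤ s) (hns : 2 ≤ n ∨ s = 1) :
    (((2 * (s : ℝ) + (BinomialEdge.longestInducedPath G : ℝ) - 2 : ℝ)) : EReal) ≤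
      BinomialEdge.regQuotient (BinomialEdge.binomialEdgeIdeal K G ^ s) := by
  have := hG.nonempty
  obtain ⟨s, rfl⟩ : ∃ k, s = k + 1 := ⟨s - 1, by omega⟩
  rcases Nat.eq_zero_or_pos (BinomialEdge.longestInducedPath G) with h0 | hl
  -- Without an edge, the exponent must be 1 and the bound is 0, which is attained by the generator
  -- of S/J in degree 0.
  · have hs : s = 0 := by
      rcases hns with hn | hs
      · have := BinomialEdge.longestInducedPath_pos hG hn
        omega
      · omega
    subst hs
    refine BinomialEdge.le_regQuotient (i := 0) (j := 0)
      (BinomialEdge.powerResolution K G le_rfl) ⟨(0 : Fin 1), rfl⟩ ?_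
    rw [h0]
    norm_num
  · obtain ⟨v⟩ := BinomialEdge.nonempty_pathGraph_embedding G
    refine BinomialEdge.le_regQuotient _ (BinomialEdge.exists_shift_eq v hl s) ?_
    push_cast
    ring
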